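/- Let $k$ be a field, $A$ an abelian group, and $S=k[x_0,\dots,x_n]$ graded by $A$ with $\deg x_i\in A$. Let $E=\Lambda_k(e_0,\dots,e_n)$ be the exterior algebra, $A\oplus\mathbb Z$-graded by $\deg e_i=(-\deg x_i;-1)$, and let $\omega_E=\operatorname{Hom}_k(E,k)$ with its induced grading and $E$-module structure. For an $A$-graded $S$-module $M$ put $\operatorname{Eff}(M)=\{a\in A: M_a\neq 0\}$, and write $a\ge a'$ if $a-a'\in\operatorname{Eff}(S)$. The module $M$ is bounded below in $A$-degrees if there is a homomorphism $\theta:A\to\mathbb Z$ with $\theta(\deg x_i)>0$ for all $i$ and $\bigoplus_{\theta(a)=i}M_a=0$ for $i\ll 0$. For $a\in A$ let $$K_a(M)=\ker\Big(M_a\otimes_k\omega_E(-a;0)\to \bigoplus_{b\in A}M_b\otimes_k\omega_E(-b;0),\quad m\otimes f\mapsto\sum_{i=0}^n x_im\otimes e_if\Big),$$ an $A\oplus\mathbb Z$-graded $E$-module. If $M$ is bounded below in $A$-degrees and $a$ is a minimal element of $\operatorname{Eff}(M)$, the ($a$-)strongly linear strand of the minimal free resolution of $M$ is, by definition, the complex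 $\mathbf L(K_a(M))$ of $S$-modules with terms and differential $$\mathbf L(K_a(M))_j=\bigoplus_{c\in A}S(-c)\otimes_k K_a(M)_{(c;j)},\qquad s\otimes y\mapsto\sum_{i=0}^n x_is\otimes e_iy .$$ It vanishes in negative degrees; its length is the largest $j$ with $\mathbf L(K_a(M))_j\ne0$. Let $W\subseteq S$ be the $k$-span of $x_0,\dots,x_n$, and let $$R_a(M)=\{w\otimes m\in W\otimes_kM_a : wm=0\text{ in }M\},$$ regarded as a closed subvariety of the affine space $\operatorname{Spec}k[W\otimes_kM_a]$: a point with residue field $\kappa$ lies in $R_a(M)$ if the corresponding element of $\kappa\otimes_kW\otimes_kM_a$ is of the form $w\otimes m$ with $w\in\kappa\otimes_k W$, $m\in\kappa\otimes_k M_a$ and $wm=0$ in $\kappa\otimes_kM$. **Theorem (Multigraded Linear Syzygy Theorem).** Let $M$ be an $A$-graded $S$-module that is bounded below in $A$-degrees, and let $a$ be a minimal element of $\operatorname{Eff}(M)$. The length of the strongly linear strand $\mathbf L(K_a(M))$ of the minimal free resolution of $M$ is at most $$\max\{\dim_kM_a-1,\ \dim R_a(M)\}$$ (where the bound is $\infty$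 if $\dim_kM_a=\infty$). -/

import Mathlib

open scoped TensorProduct DirectSum
open CategoryTheory

noncomputable section

namespace MultigradedLST

universe u v t

/-! ### Gradings

`k` is a field, `A` an abelian group, `S = k[x_0, …, x_n]` is `MvPolynomial (Fin (n + 1)) k`, graded
by `deg x_i = w i`; its degree `c` part is `MvPolynomial.weightedHomogeneousSubmodule k w c`. -/

section Gradings

variable {k : Type u} [Field k] {A : Type t} [AddCommGroup A] {n : ℕ} (w : Fin (n + 1) → A)
variable {M : Type v} [AddCommGroup M] [Module k M]

/-- `Eff(M)`: the set of degrees `a` with `M_a ≠ 0`. -/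
def Eff (ℳ : A → Submodule k M) : Set A := {a | ℳ a ≠ ⊥}

/-- The relation `a ≥ b` given by `a - b ∈ Eff(S)`. -/
def EffGE (k : Type u) [Field k] (w : Fin (n + 1) → A) (a b : A) : Prop :=
  a - b ∈ Eff (MvPolynomial.weightedHomogeneousSubmodule k w)

/-- `a` is a minimal element of `Eff(M)`. -/
def IsMinimalEff (ℳ : A → Submodule k M) (a : A) : Prop :=
  a ∈ Eff ℳ ∧ ∀ b ∈ Eff ℳ, EffGE k w a b → b = a

/-- `M` is bounded below in `A`-degrees: some homomorphism `θ : A → ℤ` makes the grading of `S`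
positive and satisfies `⨁_{θ(a) = i} M_a = 0` for `i ≪ 0`. -/
def BoundedBelow (ℳ : A → Submodule k M) : Prop :=
  ∃ θ : A →+ ℤ, (∀ i, 0 < θ (w i)) ∧ ∃ N : ℤ, ∀ a, θ a < N → ℳ a = ⊥

end Gradings

/-! ### The exterior algebra `E` and the module `ω_E` -/

section Exterior

/-- The exterior algebra `E` on `e_0, …, e_n`. -/
abbrev ExtAlg (k : Type u) [Field k] (n : ℕ) : Type u := ExteriorAlgebra k (Fin (n + 1) → k)

/-- The exterior variable `e_i`. -/
def e (k : Type u) [Field k] {n : ℕ} (i : Fin (n + 1)) : ExtAlg k n :=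
  ExteriorAlgebra.ι k (Pi.single i 1)

variable (k : Type u) [Field k] {A : Type t} [AddCommGroup A] {n : ℕ} (w : Fin (n + 1) → A)

/-- The component `E_{(c; j)}` for the `A ⊕ ℤ`-grading with `deg e_i = (-deg x_i; -1)`: it is spanned
by the monomials `e_{i_1} ⋯ e_{i_r}` with `-(w i_1 + ⋯ + w i_r) = c` and `-r = j`. -/
def extComp (c : A) (j : ℤ) : Submodule k (ExtAlg k n) :=
  Submodule.span k {y | ∃ l : List (Fin (n + 1)),
    -(l.map w).sum = c ∧ -(l.length : ℤ) = j ∧ y = (l.map (e k)).prod}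

/-- `ω_E = Hom_k(E, k)`. -/
def OmegaE (k : Type u) [Field k] (n : ℕ) : Type u := Module.Dual k (ExtAlg k n)

variable {k} in
/-- An element of `ω_E` as a functional. -/
def OmegaE.toDual (f : OmegaE k n) : Module.Dual k (ExtAlg k n) := f

instance : AddCommGroup (OmegaE k n) := inferInstanceAs (AddCommGroup (Module.Dual k (ExtAlg k n)))

instance : Module k (OmegaE k n) := inferInstanceAs (Module k (Module.Dual k (ExtAlg k n)))

/-- The left `E`-module structure of `ω_E`. As a right module, `ω_E` has `(f e) y = f (e y)`; the
associated left action is `e f = (-1)^{aux(e) aux(f)} f e` on homogeneous elements. As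
`e y = (-1)^{aux(e) aux(y)} y e`, and only `aux(y) = -aux(f) - aux(e)` matters, this is
`(e f) y = (-1)^{aux(e)} f (y e)`, where `e ↦ (-1)^{aux(e)} e` is the grade involution of `E`. -/
instance : Module (ExtAlg k n) (OmegaE k n) where
  smul x f := f.toDual ∘ₗ LinearMap.mulRight k (CliffordAlgebra.involute x)
  one_smul f := by
    refine LinearMap.ext fun y => ?_
    change f.toDual (y * CliffordAlgebra.involute 1) = _
    rw [map_one, mul_one]; rfl
  mul_smul x x' f := by
    refine LinearMap.ext fun y => ?_
    change f.toDual (y * CliffordAlgebra.involute (x * x')) =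
      f.toDual (y * CliffordAlgebra.involute x * CliffordAlgebra.involute x')
    rw [map_mul CliffordAlgebra.involute x x', mul_assoc]
  smul_zero x := rfl
  smul_add x f g := rfl
  add_smul x x' f := by
    refine LinearMap.ext fun y => ?_
    change f.toDual (y * CliffordAlgebra.involute (x + x')) =
      f.toDual (y * CliffordAlgebra.involute x) +
      f.toDual (y * CliffordAlgebra.involute x')
    rw [map_add, mul_add, map_add]
  zero_smul f := by
    refine LinearMap.ext fun y => ?_
    change f.toDual (y * CliffordAlgebra.involute 0) = 0
    rw [map_zero, mul_zero, map_zero]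

theorem OmegaE.smul_apply (x : ExtAlg k n) (f : OmegaE k n) (y : ExtAlg k n) :
    (x • f).toDual y =
      f.toDual (y * CliffordAlgebra.involute x) := rfl

instance : SMulCommClass k (ExtAlg k n) (OmegaE k n) where
  smul_comm _ _ _ := rfl

instance : SMulCommClass (ExtAlg k n) k (OmegaE k n) where
  smul_comm _ _ _ := rfl

instance : IsScalarTower k (ExtAlg k n) (OmegaE k n) where
  smul_assoc r x f := by
    refine LinearMap.ext fun y => ?_
    change f.toDual (y * CliffordAlgebra.involute (r • x)) =
      r • f.toDual (y * CliffordAlgebra.involute x)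
    rw [map_smul, mul_smul_comm, map_smul]

/-- The component `(ω_E)_{(c; j)}`: the functionals that vanish on every `E_{(c'; j')}` with
`(c'; j') ≠ (-c; -j)`. -/
def omegaComp (c : A) (j : ℤ) : Submodule k (OmegaE k n) where
  carrier := {f | ∀ c' j', (c', j') ≠ (-c, -j) → ∀ y ∈ extComp k w c' j',
    f.toDual y = 0}
  zero_mem' := fun _ _ _ _ _ => rfl
  add_mem' := fun {f g} hf hg c' j' h y hy => by
    change f.toDual y + g.toDual y = 0
    exact (congrArg₂ (· + ·) (hf c' j' h y hy) (hg c' j' h y hy)).trans (add_zero 0)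
  smul_mem' := fun r f hf c' j' h y hy => by
    change r • f.toDual y = 0
    exact (congrArg (r • ·) (hf c' j' h y hy)).trans (smul_zero r)

theorem mul_e_mem_extComp (i : Fin (n + 1)) {c : A} {j : ℤ} {y : ExtAlg k n}
    (hy : y ∈ extComp k w c j) : y * e k i ∈ extComp k w (c - w i) (j - 1) := by
  induction hy using Submodule.span_induction with
  | mem y h =>
    obtain ⟨l, h1, h2, rfl⟩ := h
    refine Submodule.subset_span ⟨l ++ [i], ?_, ?_, ?_⟩
    · rw [← h1]; simp; abel
    · rw [← h2]; simp; ring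
    · simp
  | zero => simp
  | add y z _ _ hy hz => rw [add_mul]; exact add_mem hy hz
  | smul r y _ hy => rw [smul_mul_assoc]; exact Submodule.smul_mem _ _ hy

theorem involute_e (i : Fin (n + 1)) : CliffordAlgebra.involute (e k i) = -e k i :=
  CliffordAlgebra.involute_ι _

/-- `e_i` acts on `ω_E` with degree `(-deg x_i; -1)`. -/
theorem e_smul_mem_omegaComp (i : Fin (n + 1)) {c : A} {j : ℤ} {f : OmegaE k n}
    (hf : f ∈ omegaComp k w c (j + 1)) : e k i • f ∈ omegaComp k w (c - w i) j := by
  intro c' j' h y hy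
  rw [OmegaE.smul_apply, involute_e, mul_neg, map_neg, neg_eq_zero]
  refine hf (c' - w i) (j' - 1) ?_ _ (mul_e_mem_extComp k w i hy)
  intro h'
  apply h
  rw [Prod.mk.injEq] at h' ⊢
  refine ⟨?_, by omega⟩
  rw [neg_sub, sub_eq_iff_eq_add.mp h'.1]; abel

theorem ι_mul_eq (m : Fin (n + 1) → k) (x : ExtAlg k n) :
    ExteriorAlgebra.ι k m * x = CliffordAlgebra.involute x * ExteriorAlgebra.ι k m := by
  induction x using ExteriorAlgebra.induction with
  | algebraMap r =>
    rw [AlgHom.commutes]; exact (Algebra.commutes r _).symm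
  | ι m' =>
    have h : CliffordAlgebra.involute (ExteriorAlgebra.ι k m') = -ExteriorAlgebra.ι k m' :=
      CliffordAlgebra.involute_ι _
    rw [h, neg_mul]
    exact eq_neg_of_add_eq_zero_left (ExteriorAlgebra.ι_add_mul_swap m m')
  | mul x y hx hy => rw [map_mul, ← mul_assoc, hx, mul_assoc, hy, mul_assoc]
  | add x y hx hy => rw [map_add, mul_add, add_mul, hx, hy]

end Exterior

/-! ### The functor `L` on `A ⊕ ℤ`-graded `E`-modules with trivial differential -/

section FunctorL

variable {k : Type u} [Field k] {A : Type t} [AddCommGroup A] [DecidableEq A] {n : ℕ}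
  (w : Fin (n + 1) → A)
variable {D : Type v} [AddCommGroup D] [Module k D] [Module (ExtAlg k n) D]
  [IsScalarTower k (ExtAlg k n) D]
variable (𝒟 : A → ℤ → Submodule k D)

/-- The components are compatible with the action of the elements `e_i` of degree `(-w i; -1)`. -/
def IsCompatible : Prop :=
  ∀ (i : Fin (n + 1)) (c : A) (j : ℤ), ∀ y ∈ 𝒟 c (j + 1), e k i • y ∈ 𝒟 (c - w i) j

/-- The term `L(D)_j = ⨁_c S(-c) ⊗_k D_{(c; j)}`. -/
abbrev LTerm (n : ℕ) (𝒟 : A → ℤ → Submodule k D) (j : ℤ) : Type (max u v t) :=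
  ⨁ c : A, (MvPolynomial (Fin (n + 1)) k ⊗[k] 𝒟 c j)

variable {w 𝒟}

/-- Multiplication by `e_i`, as a map `D_{(c; j + 1)} → D_{(c - w i; j)}`. -/
def eMul (h : IsCompatible w 𝒟) (i : Fin (n + 1)) (c : A) (j : ℤ) :
    𝒟 c (j + 1) →ₗ[k] 𝒟 (c - w i) j :=
  ((Algebra.lsmul k k D (e k i)).restrict (h i c j))

/-- The differential `s ⊗ d ↦ ∑ i, x_i s ⊗ e_i d` of `L(D)`. -/
def LDiff (h : IsCompatible w 𝒟) (j : ℤ) :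
    LTerm n 𝒟 (j + 1) →ₗ[MvPolynomial (Fin (n + 1)) k] LTerm n 𝒟 j :=
  DirectSum.toModule _ A _ fun c => ∑ i : Fin (n + 1),
    (DirectSum.lof (MvPolynomial (Fin (n + 1)) k) A
      (fun c => MvPolynomial (Fin (n + 1)) k ⊗[k] 𝒟 c j) (c - w i)) ∘ₗ
    TensorProduct.AlgebraTensorModule.map
      (LinearMap.mulLeft (MvPolynomial (Fin (n + 1)) k) (MvPolynomial.X i : MvPolynomial (Fin (n + 1)) k))
      (eMul h i c j)

theorem LDiff_lof (h : IsCompatible w 𝒟) (j : ℤ) (c : A) (s : MvPolynomial (Fin (n + 1)) k)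
    (y : 𝒟 c (j + 1)) :
    LDiff h j (DirectSum.lof (MvPolynomial (Fin (n + 1)) k) A
        (fun c => MvPolynomial (Fin (n + 1)) k ⊗[k] 𝒟 c (j + 1)) c (s ⊗ₜ y)) =
      ∑ i, DirectSum.lof (MvPolynomial (Fin (n + 1)) k) A
        (fun c => MvPolynomial (Fin (n + 1)) k ⊗[k] 𝒟 c j) (c - w i)
        ((MvPolynomial.X i * s) ⊗ₜ eMul h i c j y) := by
  simp [LDiff, DirectSum.toModule_lof]

theorem lof_congr (j : ℤ) {c c' : A} (hc : c = c') (s : MvPolynomial (Fin (n + 1)) k)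
    (y : 𝒟 c j) (y' : 𝒟 c' j) (hy : (y : D) = y') :
    DirectSum.lof (MvPolynomial (Fin (n + 1)) k) A
        (fun c => MvPolynomial (Fin (n + 1)) k ⊗[k] 𝒟 c j) c (s ⊗ₜ y) =
      DirectSum.lof (MvPolynomial (Fin (n + 1)) k) A
        (fun c => MvPolynomial (Fin (n + 1)) k ⊗[k] 𝒟 c j) c' (s ⊗ₜ y') := by
  subst hc
  rw [Subtype.ext hy]

theorem LDiff_comp (h : IsCompatible w 𝒟) (j : ℤ) : LDiff h j ∘ₗ LDiff h (j + 1) = 0 := by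
  refine DirectSum.linearMap_ext _ fun c => ?_
  refine TensorProduct.AlgebraTensorModule.ext fun s y => ?_
  rw [LinearMap.comp_apply, LinearMap.comp_apply, LDiff_lof, map_sum]
  simp only [LDiff_lof, LinearMap.zero_comp, LinearMap.zero_apply]
  -- the summand for the ordered pair (i, l)
  set T : Fin (n + 1) → Fin (n + 1) → LTerm n 𝒟 j := fun i l =>
    DirectSum.lof (MvPolynomial (Fin (n + 1)) k) A
        (fun c => MvPolynomial (Fin (n + 1)) k ⊗[k] 𝒟 c j) (c - w i - w l)
        ((MvPolynomial.X l * (MvPolynomial.X i * s)) ⊗ₜ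
          eMul h l (c - w i) j (eMul h i c (j + 1) y)) with hT
  have hval : ∀ i l, ((eMul h l (c - w i) j (eMul h i c (j + 1) y) : 𝒟 (c - w i - w l) j) : D) =
      (e k l * e k i) • (y : D) := fun i l => by
    rw [mul_smul]; rfl
  have hanti : ∀ i l, T i l = -T l i := fun i l => by
    rw [hT]
    dsimp only
    rw [← map_neg, ← TensorProduct.tmul_neg]
    have hs : (MvPolynomial.X l * (MvPolynomial.X i * s) : MvPolynomial (Fin (n + 1)) k) =
        MvPolynomial.X i * (MvPolynomial.X l * s) := by ring
    rw [hs]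
    refine lof_congr j (by abel) _ _ _ ?_
    rw [Submodule.coe_neg, hval, hval, ← neg_smul]
    congr 1
    exact eq_neg_of_add_eq_zero_left (ExteriorAlgebra.ι_add_mul_swap _ _)
  have hdiag : ∀ i, T i i = 0 := fun i => by
    rw [hT]
    dsimp only
    have : eMul h i (c - w i) j (eMul h i c (j + 1) y) = 0 := by
      refine Subtype.ext ?_
      rw [hval]
      have : e k i * e k i = 0 := ExteriorAlgebra.ι_sq_zero _
      rw [this, zero_smul]; rfl
    rw [this, TensorProduct.tmul_zero, map_zero]
  change ∑ i, ∑ l, T i l = 0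
  rw [← Fintype.sum_prod_type']
  refine Finset.sum_involution (fun p _ => (p.2, p.1)) ?_ ?_ ?_ ?_
  · rintro ⟨i, l⟩ _; rw [hanti i l]; exact neg_add_cancel _
  · rintro ⟨i, l⟩ _ h0 h1
    obtain rfl : l = i := congrArg Prod.fst h1
    exact h0 (hdiag l)
  · intro p _; exact Finset.mem_univ _
  · intro p _; rfl

/-- The complex `L(D)` of `S`-modules, for `D` with trivial differential. -/
def bggL (h : IsCompatible w 𝒟) : ChainComplex (ModuleCat (MvPolynomial (Fin (n + 1)) k)) ℤ :=
  ChainComplex.of (fun j => ModuleCat.of _ (LTerm n 𝒟 j)) (fun j => ModuleCat.ofHom (LDiff h j))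
    fun j => by
      rw [← ModuleCat.ofHom_comp, LDiff_comp]; rfl

end FunctorL

/-! ### `K_a(M)` and the strongly linear strand -/

section Strand

variable {k : Type u} [Field k] {A : Type t} [AddCommGroup A] {n : ℕ} (w : Fin (n + 1) → A)
variable {M : Type v} [AddCommGroup M] [Module k M] [Module (MvPolynomial (Fin (n + 1)) k) M]
  [IsScalarTower k (MvPolynomial (Fin (n + 1)) k) M]
variable (ℳ : A → Submodule k M) (a : A)

/-- The differential of `R(M)`, restricted to the summand `M_a ⊗ ω_E`, namely
`m ⊗ f ↦ ∑ i, x_i m ⊗ e_i f`. The tensor factors are written in the order `ω_E ⊗ M`, so that the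
`E`-module structures are the ones of Mathlib; `⨁_b M_b ⊗ ω_E(-b; 0)` is, without its grading,
`ω_E ⊗ M`. -/
def dR : OmegaE k n ⊗[k] ℳ a →ₗ[k] OmegaE k n ⊗[k] M :=
  ∑ i : Fin (n + 1), TensorProduct.map (Algebra.lsmul k k (OmegaE k n) (e k i))
    ((Algebra.lsmul k k M (MvPolynomial.X i : MvPolynomial (Fin (n + 1)) k)) ∘ₗ (ℳ a).subtype)

theorem dR_smul (x : ExtAlg k n) (y : OmegaE k n ⊗[k] ℳ a) :
    dR ℳ a (x • y) = CliffordAlgebra.involute x • dR ℳ a y := by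
  induction y using TensorProduct.induction_on with
  | zero => simp
  | add y z hy hz => rw [smul_add, map_add, hy, hz, map_add, smul_add]
  | tmul f m =>
    rw [TensorProduct.smul_tmul']
    simp only [dR, LinearMap.sum_apply, TensorProduct.map_tmul, Finset.smul_sum,
      TensorProduct.smul_tmul', Algebra.lsmul_coe]
    refine Finset.sum_congr rfl fun i _ => ?_
    rw [smul_smul, smul_smul]
    congr 2
    exact ι_mul_eq k _ x

/-- The `E`-module `K_a(M) = ker (M_a ⊗ ω_E(-a; 0) → R(M))`. -/
def Kmod : Submodule (ExtAlg k n) (OmegaE k n ⊗[k] ℳ a) where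
  carrier := {y | dR ℳ a y = 0}
  zero_mem' := map_zero _
  add_mem' := fun {y z} (hy : dR ℳ a y = 0) (hz : dR ℳ a z = 0) => by
    change dR ℳ a (y + z) = 0
    rw [map_add, hy, hz, add_zero]
  smul_mem' := fun x y (hy : dR ℳ a y = 0) => by
    change dR ℳ a (x • y) = 0
    rw [dR_smul, hy, smul_zero]

/-- The component of degree `(c; j)` of `M_a ⊗ ω_E(-a; 0)`, namely `M_a ⊗ (ω_E)_{(c - a; j)}`. -/
def summandComp (c : A) (j : ℤ) : Submodule k (OmegaE k n ⊗[k] ℳ a) :=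
  LinearMap.range (LinearMap.rTensor (ℳ a) (omegaComp k w (c - a) j).subtype)

/-- The component `K_a(M)_{(c; j)}`, inside `M_a ⊗ ω_E(-a; 0)`. -/
def Kcomp (c : A) (j : ℤ) : Submodule k (OmegaE k n ⊗[k] ℳ a) :=
  (Kmod ℳ a).restrictScalars k ⊓ summandComp w ℳ a c j

theorem e_smul_mem_summandComp (i : Fin (n + 1)) (c : A) (j : ℤ) {y : OmegaE k n ⊗[k] ℳ a}
    (hy : y ∈ summandComp w ℳ a c (j + 1)) :
    e k i • y ∈ summandComp w ℳ a (c - w i) j := by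
  obtain ⟨z, rfl⟩ := hy
  induction z using TensorProduct.induction_on with
  | zero => simp
  | add z z' hz hz' => rw [map_add, smul_add]; exact add_mem hz hz'
  | tmul f m =>
    have hf := e_smul_mem_omegaComp k w i f.2
    rw [sub_right_comm] at hf
    exact ⟨(⟨e k i • (f : OmegaE k n), hf⟩ : omegaComp k w (c - w i - a) j) ⊗ₜ m, rfl⟩

theorem Kcomp_compatible : IsCompatible w (Kcomp w ℳ a) :=
  fun i c j _ hy => ⟨(Kmod ℳ a).smul_mem (e k i) hy.1, e_smul_mem_summandComp w ℳ a i c j hy.2⟩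

/-- The `a`-strongly linear strand `L(K_a(M))` of the minimal free resolution of `M`. -/
def stronglyLinearStrand [DecidableEq A] :
    ChainComplex (ModuleCat (MvPolynomial (Fin (n + 1)) k)) ℤ :=
  bggL (Kcomp_compatible w ℳ a)

end Strand

/-- The length of a complex `C_0 ← C_1 ← ⋯` (zero in negative degrees, as strongly linear strands
are): the supremum of the `j` with `C_j ≠ 0`. -/
def complexLength {R : Type*} [Ring R] (C : ChainComplex (ModuleCat R) ℤ) : ℕ∞ :=
  ⨆ (j : ℕ) (_ : Nontrivial (C.X (j : ℤ))), (j : ℕ∞)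

/-! ### The variety of rank one linear syzygies -/

section RankOne

variable {k : Type u} [Field k] {A : Type t} {n : ℕ}
variable {M : Type v} [AddCommGroup M] [Module k M] [Module (MvPolynomial (Fin (n + 1)) k) M]
variable (ℳ : A → Submodule k M) (a : A)

/-- The index set of a basis of `M_a`. -/
abbrev BasisIndex : Type v := Module.Basis.ofVectorSpaceIndex k (ℳ a)

/-- The coordinate ring `k[W ⊗ M_a]`, where `W` is spanned by `x_0, …, x_n`: the variable `(i, l)` is
the coordinate function at the element `x_i ⊗ b_l` of the basis of `W ⊗ M_a`. -/
abbrev CoordRing (n : ℕ) (ℳ : A → Submodule k M) (a : A) : Type (max u v) :=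
  MvPolynomial (Fin (n + 1) × BasisIndex ℳ a) k

/-- `R_a(M)`, as a subset of `Spec k[W ⊗ M_a]`. A point `p` with residue field `κ` is an element of
`κ ⊗ (W ⊗ M_a)`; it belongs to `R_a(M)` when this element has the form `w ⊗ m`, with `w = ∑ u_i x_i`
and `m = ∑ v_l b_l` over `κ`, and `w m = 0` in `κ ⊗ M`. -/
def rankOneSyzygies (n : ℕ) {M : Type v} [AddCommGroup M] [Module k M]
    [Module (MvPolynomial (Fin (n + 1)) k) M] (ℳ : A → Submodule k M) (a : A) :
    Set (PrimeSpectrum (CoordRing n ℳ a)) :=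
  {p | ∃ (u : Fin (n + 1) → p.asIdeal.ResidueField) (v : BasisIndex ℳ a →₀ p.asIdeal.ResidueField),
    (∀ i l, algebraMap (CoordRing n ℳ a) p.asIdeal.ResidueField (MvPolynomial.X (i, l)) = u i * v l) ∧
    ∑ i, v.sum (fun l c => (u i * c) ⊗ₜ[k] ((MvPolynomial.X i : MvPolynomial (Fin (n + 1)) k) •
      (Module.Basis.ofVectorSpace k (ℳ a) l : M))) =
      (0 : p.asIdeal.ResidueField ⊗[k] M)}

end RankOne

end MultigradedLST

end

/-!
Suppose `K_a(M)` has a nonzero element of degree `(c; j)` with `j ≥ m := dim M_a`; we need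
`j ≤ dim R_a(M)`. Let `r = n + 2 - j`, and take `r` linear combinations of the coordinates of the
multiplication `W ⊗ M_a → M` with algebraically independent coefficients, over an algebraically
closed field `Ω`. They are `r` vectors `ν` of `n + 1` linear forms in `m` variables, regarded as
elements of `Ω[X] ⊗ E`.

If the vectors stay independent at every point `u ≠ 0`, then exactness of multiplication by an
independent family in the exterior algebra shows, away from the origin and hence up to a truncation
in low degrees, that they form a regular sequence. The product of a variable, a monomial of degree
`j` in the `e_i` and the `r` vectors vanishes, as it has exterior degree `n + 2`. So the variable
times the monomial lies in the left ideal of the `ν`, on which every element of `K_a(M)`, viewed as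
a functional, vanishes: the given element is zero, a contradiction.

If the vectors are dependent at some `u ≠ 0`, some `w ⊗ u` is a point of `R_a(M)`, and counting
transcendence degrees shows that `w` can be chosen so that the coordinates `w_i u_l` have
transcendence degree at least `n + 2 - r = j`.
-/

noncomputable section

namespace MultigradedLST

section Regularity

variable {X σ : Type*} [Ring X] [SetLike σ X] {𝒜 : ℕ → σ}

theorem exists_mem_sub_mul_mem_of_isHomogeneous [AddSubgroupClass σ X] [GradedRing 𝒜]
    {I : Ideal X} (hI : I.IsHomogeneous 𝒜) {t : X}
    (ht : t ∈ 𝒜 1) {d : ℕ} {x : X} (hx : x ∈ 𝒜 (d + 1))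
    (hxI : x ∈ I ⊔ Ideal.span {t}) : ∃ g ∈ 𝒜 d, x - g * t ∈ I := by
  obtain ⟨y, hy, _, hgt, rfl⟩ := Submodule.mem_sup.1 hxI
  obtain ⟨g, rfl⟩ := Ideal.mem_span_singleton'.1 hgt
  refine ⟨DirectSum.decompose 𝒜 g d, SetLike.coe_mem _, ?_⟩
  have hcomp : y + g * t - DirectSum.decompose 𝒜 g d * t = DirectSum.decompose 𝒜 y (d + 1) := by
    rw [sub_eq_iff_eq_add, ← DirectSum.coe_decompose_mul_add_of_right_mem 𝒜 ht,
      ← DirectSum.decompose_of_mem_same 𝒜 hx, DirectSum.decompose_add, DirectSum.add_apply,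
      AddMemClass.coe_add]
  rw [hcomp]
  exact hI (d + 1) hy

variable {r m : ℕ} (ν : Fin r → X) (z : Fin m → X)

/-- The left ideal generated by the first `i` of the elements `ν` and the first `b` of the
elements `z`, through which the regularity argument proceeds. -/
def truncIdeal (i b : ℕ) : Ideal X := Ideal.span (ν '' {a | a.val < i} ∪ z '' {c | c.val < b})

variable {ν z}

theorem image_val_lt_succ {Y : Type*} {p : ℕ} (f : Fin p → Y) (a : Fin p) :
    f '' {c | c.val < a.val + 1} = insert (f a) (f '' {c | c.val < a.val}) := by
  rw [← Set.image_insert_eq]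
  congr 1
  ext c
  simp only [Set.mem_ofPred_eq, Set.mem_insert_iff, Fin.ext_iff]
  omega

theorem truncIdeal_succ_left (a : Fin r) (b : ℕ) :
    truncIdeal ν z (a + 1) b = truncIdeal ν z a b ⊔ Ideal.span {ν a} := by
  rw [truncIdeal, image_val_lt_succ, Set.insert_union, Ideal.span_insert, sup_comm, truncIdeal]

theorem truncIdeal_succ_right (i : ℕ) (c : Fin m) :
    truncIdeal ν z i (c + 1) = truncIdeal ν z i c ⊔ Ideal.span {z c} := by
  rw [truncIdeal, image_val_lt_succ, Set.union_insert, Ideal.span_insert, sup_comm, truncIdeal]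

theorem mul_mem_truncIdeal_succ_left (g : X) (a : Fin r) (b : ℕ) :
    g * ν a ∈ truncIdeal ν z (a + 1) b :=
  Ideal.mul_mem_left _ g (Ideal.subset_span (Or.inl ⟨a, a.val.lt_succ_self, rfl⟩))

theorem mul_mem_truncIdeal_succ_right (g : X) (i : ℕ) (c : Fin m) :
    g * z c ∈ truncIdeal ν z i (c + 1) :=
  Ideal.mul_mem_left _ g (Ideal.subset_span (Or.inr ⟨c, c.val.lt_succ_self, rfl⟩))

theorem truncIdeal_mono {i i' b b' : ℕ} (hi : i ≤ i') (hb : b ≤ b') :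
    truncIdeal ν z i b ≤ truncIdeal ν z i' b' :=
  Ideal.span_mono (Set.union_subset_union (Set.image_mono fun _ h => lt_of_lt_of_le h hi)
    (Set.image_mono fun _ h => lt_of_lt_of_le h hb))

variable (𝒜 ν z) in
/-- `z` is a regular sequence of central elements of degree `1` that generates the positive
degrees of a graded ring, `ν` is a sequence of anticommuting elements of degree `1`, and `torsion`
says that, modulo the first `i` of them, `ν i` is exact away from the common zeros of `z`. -/
structure RegularAwayFromZeros : Prop where
  z_mem : ∀ c, z c ∈ 𝒜 1
  commute : ∀ c x, Commute (z c) x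
  regular : ∀ (c : Fin m) (x : X), x * z c ∈ truncIdeal ν z 0 c → x ∈ truncIdeal ν z 0 c
  mem_of_pos : ∀ d, ∀ x ∈ 𝒜 (d + 1), x ∈ truncIdeal ν z 0 m
  ν_mem : ∀ a, ν a ∈ 𝒜 1
  anticomm : ∀ a b, ν a * ν b = -(ν b * ν a)
  sq_zero : ∀ a, ν a * ν a = 0
  torsion : ∀ (a : Fin r) (c : Fin m) (x : X), x * ν a ∈ truncIdeal ν z a c →
    ∃ N : ℕ, x * z c ^ N ∈ truncIdeal ν z (a + 1) c

namespace RegularAwayFromZeros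

variable (h : RegularAwayFromZeros 𝒜 ν z)
include h

theorem mul_ν_mem_truncIdeal {i b : ℕ} {x : X} (hx : x ∈ truncIdeal ν z i b) (a : Fin r) :
    x * ν a ∈ truncIdeal ν z i b := by
  induction hx using Submodule.span_induction with
  | mem x hx =>
    rcases hx with ⟨c, hc, rfl⟩ | ⟨c, hc, rfl⟩
    · rw [h.anticomm, ← neg_mul]
      exact Ideal.mul_mem_left _ _ (Ideal.subset_span (Or.inl ⟨c, hc, rfl⟩))
    · rw [(h.commute c _).eq]
      exact Ideal.mul_mem_left _ _ (Ideal.subset_span (Or.inr ⟨c, hc, rfl⟩))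
  | zero => simp
  | add x y _ _ hx hy => rw [add_mul]; exact add_mem hx hy
  | smul g x _ hx => rw [smul_eq_mul, mul_assoc]; exact Ideal.mul_mem_left _ _ hx

variable [AddSubgroupClass σ X] [GradedRing 𝒜]

theorem isHomogeneous_truncIdeal (i b : ℕ) :
    (truncIdeal ν z i b).IsHomogeneous 𝒜 :=
  Ideal.homogeneous_span 𝒜 _ (by
    rintro _ (⟨a, -, rfl⟩ | ⟨c, -, rfl⟩)
    · exact ⟨1, h.ν_mem a⟩
    · exact ⟨1, h.z_mem c⟩)

theorem mem_of_mul_z_pow_mem {I : Ideal X} (c : Fin m)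
    (hreg : ∀ d, ∀ x ∈ 𝒜 (d + 1), x * z c ∈ I → x ∈ I) (N d : ℕ) {x : X} (hx : x ∈ 𝒜 (d + 1))
    (hN : x * z c ^ N ∈ I) : x ∈ I := by
  induction N generalizing d x with
  | zero => simpa using hN
  | succ N ih =>
    refine hreg d x hx (ih (d + 1) (SetLike.mul_mem_graded hx (h.z_mem c)) ?_)
    rwa [mul_assoc, ← pow_succ']

/-- If `x z_c = g ν_a` modulo the ideal, then `g` lies in the next ideal by exactness, and
rewriting it there shows that `x` is a multiple of `ν_a` up to an element killed by `z_c`. -/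
theorem mem_of_mul_z_mem_succ (a : Fin r) (c : Fin m)
    (hreg : ∀ d, ∀ x ∈ 𝒜 (d + 1), x * z c ∈ truncIdeal ν z a c → x ∈ truncIdeal ν z a c)
    (hexact : ∀ d, ∀ x ∈ 𝒜 (d + 1), x * ν a ∈ truncIdeal ν z a (c + 1) →
      x ∈ truncIdeal ν z (a + 1) (c + 1))
    (d : ℕ) (x : X) (hx : x ∈ 𝒜 (d + 1)) (hxz : x * z c ∈ truncIdeal ν z (a + 1) c) :
    x ∈ truncIdeal ν z (a + 1) c := by
  have hhom := h.isHomogeneous_truncIdeal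
  obtain ⟨g, hg, hxg⟩ := exists_mem_sub_mul_mem_of_isHomogeneous (hhom a c) (h.ν_mem a)
    (SetLike.mul_mem_graded hx (h.z_mem c)) ((truncIdeal_succ_left a c).le hxz)
  have hgν : g * ν a ∈ truncIdeal ν z a (c + 1) := by
    rw [← sub_sub_cancel (x * z c) (g * ν a)]
    exact sub_mem (mul_mem_truncIdeal_succ_right x a c)
      (truncIdeal_mono le_rfl c.val.le_succ hxg)
  obtain ⟨p, hp, hgp⟩ := exists_mem_sub_mul_mem_of_isHomogeneous (hhom (a + 1) c) (h.z_mem c) hg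
    ((truncIdeal_succ_right (a + 1) c).le (hexact d g hg hgν))
  obtain ⟨q, -, hgpq⟩ := exists_mem_sub_mul_mem_of_isHomogeneous (hhom a c) (h.ν_mem a)
    (sub_mem hg (SetLike.mul_mem_graded hp (h.z_mem c))) ((truncIdeal_succ_left a c).le hgp)
  have hres : (x - p * ν a) * z c ∈ truncIdeal ν z a c := by
    have hexpand : (x - p * ν a) * z c =
        (x * z c - g * ν a) + (g - p * z c - q * ν a) * ν a := by
      rw [sub_mul x, sub_mul _ (q * ν a), sub_mul g, mul_assoc q, h.sq_zero, mul_assoc p (z c),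
        (h.commute c _).eq, mul_assoc p (ν a)]
      noncomm_ring
    rw [hexpand]
    exact add_mem hxg (h.mul_ν_mem_truncIdeal hgpq a)
  have hx' := hreg d _ (sub_mem hx (SetLike.mul_mem_graded hp (h.ν_mem a))) hres
  have hpν : p * ν a ∈ truncIdeal ν z (a + 1) c := mul_mem_truncIdeal_succ_left p a c
  rw [← sub_add_cancel x (p * ν a)]
  exact add_mem (truncIdeal_mono a.val.le_succ le_rfl hx') hpν

theorem mem_succ_of_mul_ν_mem_of_regular (a : Fin r)
    (hreg : ∀ (c : Fin m) (d : ℕ), ∀ x ∈ 𝒜 (d + 1), x * z c ∈ truncIdeal ν z a c →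
      x ∈ truncIdeal ν z a c)
    {b : ℕ} (hb : b ≤ m) (d : ℕ) (x : X) (hx : x ∈ 𝒜 (d + 1))
    (hxν : x * ν a ∈ truncIdeal ν z a b) : x ∈ truncIdeal ν z (a + 1) b := by
  induction hb using Nat.decreasingInduction generalizing d x with
  | self => exact truncIdeal_mono (Nat.zero_le _) le_rfl (h.mem_of_pos d x hx)
  | of_succ b hb ih =>
    obtain ⟨N, hN⟩ := h.torsion a ⟨b, hb⟩ x hxν
    exact h.mem_of_mul_z_pow_mem ⟨b, hb⟩
      (h.mem_of_mul_z_mem_succ a ⟨b, hb⟩ (hreg ⟨b, hb⟩) ih) N d hx hN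

theorem mem_of_mul_z_mem {i : ℕ} (hi : i ≤ r) (c : Fin m) (d : ℕ) (x : X)
    (hx : x ∈ 𝒜 (d + 1)) (hxz : x * z c ∈ truncIdeal ν z i c) : x ∈ truncIdeal ν z i c := by
  induction i generalizing c d x with
  | zero => exact h.regular c x hxz
  | succ i ih =>
    have hreg := ih (Nat.le_of_succ_le hi)
    exact h.mem_of_mul_z_mem_succ ⟨i, hi⟩ c (hreg c)
      (h.mem_succ_of_mul_ν_mem_of_regular ⟨i, hi⟩ hreg c.isLt) d x hx hxz

theorem mem_succ_of_mul_ν_mem (a : Fin r) {d : ℕ} {x : X} (hx : x ∈ 𝒜 (d + 1))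
    (hxν : x * ν a ∈ truncIdeal ν z a 0) : x ∈ truncIdeal ν z (a + 1) 0 :=
  h.mem_succ_of_mul_ν_mem_of_regular a (h.mem_of_mul_z_mem a.isLt.le) (Nat.zero_le m) d x hx hxν

theorem mem_of_mul_prod_eq_zero {i : ℕ} (hi : i ≤ r) {d : ℕ} {x : X}
    (hx : x ∈ 𝒜 (d + 1)) (hprod : x * ((List.ofFn ν).take i).reverse.prod = 0) :
    x ∈ truncIdeal ν z i 0 := by
  induction i generalizing d x with
  | zero =>
    rw [List.take_zero, List.reverse_nil, List.prod_nil, mul_one] at hprod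
    rw [hprod]
    exact zero_mem _
  | succ i ih =>
    refine h.mem_succ_of_mul_ν_mem ⟨i, hi⟩ hx
      (ih (Nat.le_of_succ_le hi) (SetLike.mul_mem_graded hx (h.ν_mem ⟨i, hi⟩)) ?_)
    rw [List.take_succ_eq_append_getElem (by simpa using hi), List.reverse_append,
      List.reverse_singleton, List.singleton_append, List.prod_cons, List.getElem_ofFn] at hprod
    rwa [mul_assoc]

end RegularAwayFromZeros

end Regularity

section PolynomialGrading

open MvPolynomial Algebra.TensorProduct

variable {k : Type*} [Field k] {Λ : Type*} [Ring Λ] [Algebra k Λ]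

theorem mul_mem_decomposeTensor {S ι : Type*} [CommRing S] [Algebra k S] [AddMonoid ι]
    (𝒮 : ι → Submodule k S) [SetLike.GradedMonoid 𝒮] {i j : ι} {x y : S ⊗[k] Λ}
    (hx : x ∈ DirectSum.decomposeTensor 𝒮 Λ i) (hy : y ∈ DirectSum.decomposeTensor 𝒮 Λ j) :
    x * y ∈ DirectSum.decomposeTensor 𝒮 Λ (i + j) := by
  obtain ⟨x, rfl⟩ := hx
  obtain ⟨y, rfl⟩ := hy
  induction x with
  | zero => simp
  | add x x' hx hx' => rw [map_add, add_mul]; exact add_mem hx hx'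
  | tmul p u =>
    induction y with
    | zero => simp
    | add y y' hy hy' => rw [map_add, mul_add]; exact add_mem hy hy'
    | tmul q v =>
      exact ⟨⟨p * q, SetLike.mul_mem_graded p.2 q.2⟩ ⊗ₜ (u * v), (tmul_mul_tmul _ _ _ _).symm⟩

variable {σ Ω : Type*} [Field Ω] [Algebra k Ω]

/-- The grading of `Ω[X] ⊗ Λ` by the polynomial degree. -/
def polyDegree (d : ℕ) : Submodule k (MvPolynomial σ Ω ⊗[k] Λ) :=
  DirectSum.decomposeTensor (fun d => (homogeneousSubmodule σ Ω d).restrictScalars k) Λ d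

theorem tmul_mem_polyDegree {d : ℕ} {p : MvPolynomial σ Ω} (hp : p.IsHomogeneous d) (y : Λ) :
    p ⊗ₜ[k] y ∈ polyDegree (k := k) d :=
  ⟨⟨p, hp⟩ ⊗ₜ y, rfl⟩

instance : GradedRing (polyDegree (k := k) (Λ := Λ) (σ := σ) (Ω := Ω)) where
  one_mem := tmul_mem_polyDegree (isHomogeneous_one _ _) 1
  mul_mem _ _ _ _ hx hy :=
    haveI : SetLike.GradedMonoid fun d => (homogeneousSubmodule σ Ω d).restrictScalars k :=
      { one_mem := isHomogeneous_one σ Ω, mul_mem := fun _ _ _ _ hp hq => IsHomogeneous.mul hp hq }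
    mul_mem_decomposeTensor _ hx hy
  toDecomposition :=
    letI := decomposition (σ := σ) (R := Ω)
    haveI : DirectSum.Decomposition fun d => (homogeneousSubmodule σ Ω d).restrictScalars k :=
      inferInstanceAs (DirectSum.Decomposition (homogeneousSubmodule σ Ω))
    DirectSum.tensorDecomposition _ Λ

variable {m : ℕ}

variable (k Λ Ω) in
/-- The variable `X c` as an element of `Ω[X] ⊗ Λ`. -/
def polyVar (c : Fin m) : MvPolynomial (Fin m) Ω ⊗[k] Λ :=
  algebraMap (MvPolynomial (Fin m) Ω) _ (X c)

theorem mul_polyVar_pow (c : Fin m) (N : ℕ) (x : MvPolynomial (Fin m) Ω ⊗[k] Λ) :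
    x * polyVar k Λ Ω c ^ N = (X c ^ N : MvPolynomial (Fin m) Ω) • x := by
  rw [polyVar, ← map_pow, ← Algebra.commutes]
  exact (Algebra.smul_def _ _).symm

variable (Ω) in
/-- The substitution `X c ↦ 0` for `c < b`, whose kernel is the ideal of these variables. -/
def killVars (b : ℕ) : MvPolynomial (Fin m) Ω →ₐ[Ω] MvPolynomial (Fin m) Ω :=
  aeval fun c => if c.val < b then 0 else X c

theorem sub_killVars_mem_span (b : ℕ) (p : MvPolynomial (Fin m) Ω) :
    p - killVars Ω b p ∈ Ideal.span (X '' {c : Fin m | c.val < b}) := by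
  set J : Ideal (MvPolynomial (Fin m) Ω) := Ideal.span (X '' {c : Fin m | c.val < b})
  have hmk : (Ideal.Quotient.mkₐ Ω J).comp (killVars Ω b) = Ideal.Quotient.mkₐ Ω J := by
    refine MvPolynomial.algHom_ext fun c => ?_
    by_cases hc : c.val < b
    · have hX : X c ∈ J := Ideal.subset_span ⟨c, hc, rfl⟩
      simpa [killVars, hc] using (Ideal.Quotient.eq_zero_iff_mem.2 hX).symm
    · simp [killVars, hc]
  exact Ideal.Quotient.eq.1 (AlgHom.congr_fun hmk p).symm

theorem killVars_eq_zero_of_isHomogeneous {d : ℕ} {p : MvPolynomial (Fin m) Ω}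
    (hp : p.IsHomogeneous (d + 1)) : killVars Ω m p = 0 := by
  have hzero : (fun c : Fin m => if c.val < m then 0 else (X c : MvPolynomial (Fin m) Ω)) = 0 := by
    ext1 c
    simp
  rw [killVars, hzero, aeval_zero, constantCoeff_eq, hp.coeff_eq_zero (by simp), map_zero]

variable (k Λ Ω) in
/-- The substitution `killVars` on `Ω[X] ⊗ Λ`. -/
def killVarsTensor (b : ℕ) : MvPolynomial (Fin m) Ω ⊗[k] Λ →ₐ[k] MvPolynomial (Fin m) Ω ⊗[k] Λ :=
  Algebra.TensorProduct.map ((killVars Ω b).restrictScalars k) (AlgHom.id k Λ)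

variable {r : ℕ} {ν : Fin r → MvPolynomial (Fin m) Ω ⊗[k] Λ}

theorem sub_killVarsTensor_mem (b : ℕ) (x : MvPolynomial (Fin m) Ω ⊗[k] Λ) :
    x - killVarsTensor k Λ Ω b x ∈ truncIdeal ν (polyVar k Λ Ω) 0 b := by
  induction x with
  | zero => simp
  | add x x' hx hx' => rw [map_add, add_sub_add_comm]; exact add_mem hx hx'
  | tmul p y =>
    have hspan : Ideal.span (X '' {c : Fin m | c.val < b}) ≤
        (truncIdeal ν (polyVar k Λ Ω) 0 b).comap
          (algebraMap (MvPolynomial (Fin m) Ω) (MvPolynomial (Fin m) Ω ⊗[k] Λ)) := by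
      rw [Ideal.span_le]
      rintro _ ⟨c, hc, rfl⟩
      exact Ideal.subset_span (Or.inr ⟨c, hc, rfl⟩)
    have hmul := Ideal.mul_mem_left _ ((1 : MvPolynomial (Fin m) Ω) ⊗ₜ[k] y)
      (Ideal.mem_comap.1 (hspan (sub_killVars_mem_span b p)))
    rwa [Algebra.TensorProduct.algebraMap_apply, Algebra.algebraMap_self, RingHom.id_apply,
      tmul_mul_tmul, one_mul, mul_one, TensorProduct.sub_tmul] at hmul

theorem killVarsTensor_eq_zero_of_mem {b : ℕ} {x : MvPolynomial (Fin m) Ω ⊗[k] Λ}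
    (hx : x ∈ truncIdeal ν (polyVar k Λ Ω) 0 b) : killVarsTensor k Λ Ω b x = 0 := by
  have hle : truncIdeal ν (polyVar k Λ Ω) 0 b ≤ RingHom.ker (killVarsTensor k Λ Ω b) := by
    refine Ideal.span_le.2 ?_
    rintro _ (⟨a, ha, rfl⟩ | ⟨c, hc : c.val < b, rfl⟩)
    · exact absurd ha (Nat.not_lt_zero _)
    · simp [killVarsTensor, killVars, polyVar, hc]
  exact hle hx

theorem mem_truncIdeal_of_mul_polyVar_mem (c : Fin m) {x : MvPolynomial (Fin m) Ω ⊗[k] Λ}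
    (hx : x * polyVar k Λ Ω c ∈ truncIdeal ν (polyVar k Λ Ω) 0 c) :
    x ∈ truncIdeal ν (polyVar k Λ Ω) 0 c := by
  have hfix : killVarsTensor k Λ Ω c (polyVar k Λ Ω c) = polyVar k Λ Ω c := by
    simp [killVarsTensor, killVars, polyVar]
  have hkill := killVarsTensor_eq_zero_of_mem hx
  rw [map_mul, hfix, ← pow_one (polyVar k Λ Ω c), mul_polyVar_pow, pow_one] at hkill
  have hsub := sub_killVarsTensor_mem (ν := ν) c x
  rwa [(smul_eq_zero.1 hkill).resolve_left (X_ne_zero c), sub_zero] at hsub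

theorem mem_truncIdeal_of_mem_polyDegree {d : ℕ} {x : MvPolynomial (Fin m) Ω ⊗[k] Λ}
    (hx : x ∈ polyDegree (k := k) (d + 1)) : x ∈ truncIdeal ν (polyVar k Λ Ω) 0 m := by
  have hkill : killVarsTensor k Λ Ω m x = 0 := by
    obtain ⟨x, rfl⟩ := hx
    induction x with
    | zero => simp
    | add x x' hx hx' => rw [map_add, map_add, hx, hx', add_zero]
    | tmul p y => simp [killVarsTensor, killVars_eq_zero_of_isHomogeneous p.2]
  simpa only [hkill, sub_zero] using sub_killVarsTensor_mem (ν := ν) m x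

end PolynomialGrading

section ExteriorVectors

open Algebra.TensorProduct

variable {k : Type*} [Field k] {n : ℕ} {S : Type*} [CommRing S] [Algebra k S]

theorem sum_mul_sum_self_eq_zero {ι X : Type*} [Ring X] (f : ι → X) (hsq : ∀ i, f i * f i = 0)
    (hanti : ∀ i j, f i * f j = -(f j * f i)) (s : Finset ι) :
    (∑ i ∈ s, f i) * ∑ i ∈ s, f i = 0 := by
  classical
  induction s using Finset.induction_on with
  | empty => simp
  | insert a s ha ih =>
    have hswap : f a * ∑ i ∈ s, f i = -((∑ i ∈ s, f i) * f a) := by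
      rw [Finset.mul_sum, Finset.sum_mul, ← Finset.sum_neg_distrib]
      exact Finset.sum_congr rfl fun i _ => hanti a i
    rw [Finset.sum_insert ha, add_mul, mul_add, mul_add, hsq, hswap, ih]
    abel

/-- The vector `∑ i, p i ⊗ e i` of the exterior algebra with coefficients in `S`. -/
def extVec (k : Type*) [Field k] [Algebra k S] (p : Fin (n + 1) → S) : S ⊗[k] ExtAlg k n :=
  ∑ i, p i ⊗ₜ e k i

theorem extVec_mul_self (p : Fin (n + 1) → S) : extVec k p * extVec k p = 0 := by
  refine sum_mul_sum_self_eq_zero _ (fun i => ?_) (fun i j => ?_) _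
  · rw [tmul_mul_tmul, e, ExteriorAlgebra.ι_sq_zero, TensorProduct.tmul_zero]
  · rw [tmul_mul_tmul, tmul_mul_tmul, mul_comm, ← TensorProduct.tmul_neg]
    exact congrArg _ (eq_neg_of_add_eq_zero_left (ExteriorAlgebra.ι_add_mul_swap _ _))

theorem extVec_mul_extVec_comm (p q : Fin (n + 1) → S) :
    extVec k p * extVec k q = -(extVec k q * extVec k p) := by
  have hadd : extVec k (p + q) = extVec k p + extVec k q := by
    simp only [extVec, Pi.add_apply, TensorProduct.add_tmul, Finset.sum_add_distrib]
  have hsq := extVec_mul_self (k := k) (p + q)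
  rw [hadd, add_mul, mul_add, mul_add, extVec_mul_self, extVec_mul_self, zero_add, add_zero] at hsq
  exact eq_neg_of_add_eq_zero_left hsq

theorem prod_e_eq_zero (s : List (Fin (n + 1))) (hs : n + 1 < s.length) :
    (s.map (e k)).prod = 0 := by
  have hι : (s.map (e k)).prod =
      ExteriorAlgebra.ιMulti k s.length fun i => Pi.single (s.get i) (1 : k) := by
    rw [ExteriorAlgebra.ιMulti_apply]
    conv_lhs => rw [← List.ofFn_get s, List.map_ofFn]
    rfl
  rw [hι]
  refine AlternatingMap.map_eq_zero_of_not_injective _ _ fun hinj => ?_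
  have hget : Function.Injective s.get := fun i j hij => hinj (by simp only [hij])
  have hcard := Fintype.card_le_of_injective _ hget
  simp only [Fintype.card_fin] at hcard
  omega

theorem tmul_prod_e_mul_prod_extVec_eq_zero (L : List (Fin (n + 1) → S)) (q : S)
    (s : List (Fin (n + 1))) (hs : n + 1 < s.length + L.length) :
    (q ⊗ₜ[k] (s.map (e k)).prod) * (L.map (extVec k)).prod = 0 := by
  induction L generalizing q s with
  | nil => rw [prod_e_eq_zero s hs, TensorProduct.tmul_zero, zero_mul]
  | cons p L ih =>
    rw [List.map_cons, List.prod_cons, ← mul_assoc, extVec, Finset.mul_sum, Finset.sum_mul]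
    refine Finset.sum_eq_zero fun i _ => ?_
    have hsnoc : (s.map (e k)).prod * e k i = ((s ++ [i]).map (e k)).prod := by simp
    rw [tmul_mul_tmul, hsnoc]
    exact ih _ _ (by
      simp only [List.length_append, List.length_cons, List.length_nil] at hs ⊢
      omega)

/-- Right contraction of `E` with the `s`-th coordinate functional. -/
def contr (s : Fin (n + 1)) : ExtAlg k n →ₗ[k] ExtAlg k n :=
  (CliffordAlgebra.contractRight (Q := (0 : QuadraticForm k (Fin (n + 1) → k)))).flip
    (LinearMap.proj s)

theorem contr_mul_e (s i : Fin (n + 1)) (y : ExtAlg k n) :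
    contr s (y * e k i) = (Pi.single i 1 : Fin (n + 1) → k) s • y - contr s y * e k i :=
  CliffordAlgebra.contractRight_mul_ι (Q := (0 : QuadraticForm k (Fin (n + 1) → k)))
    (d := LinearMap.proj s) _ _

/-- Right contraction of `S ⊗ E` with the functional whose coordinates are `w`. -/
def vecContr (w : Fin (n + 1) → S) : S ⊗[k] ExtAlg k n →ₗ[S] S ⊗[k] ExtAlg k n :=
  ∑ s, w s • (contr s).baseChange S

theorem vecContr_mul_tmul_e (w : Fin (n + 1) → S) (p : S) (i : Fin (n + 1))
    (x : S ⊗[k] ExtAlg k n) :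
    vecContr w (x * p ⊗ₜ e k i) = (p * w i) • x - vecContr w x * p ⊗ₜ e k i := by
  induction x with
  | zero => simp
  | add x x' hx hx' => rw [add_mul, map_add, hx, hx', map_add, add_mul, smul_add]; abel
  | tmul c y =>
    have hsingle : ∑ s, w s • ((c * p) ⊗ₜ[k] ((Pi.single i 1 : Fin (n + 1) → k) s • y)) =
        (p * w i) • c ⊗ₜ[k] y := by
      rw [Finset.sum_eq_single i (fun s _ hs => by simp [hs]) (by simp), Pi.single_eq_same,
        one_smul, mul_comm p, mul_smul, TensorProduct.smul_tmul' p, smul_eq_mul, mul_comm p]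
    simp only [vecContr, LinearMap.sum_apply, LinearMap.smul_apply, LinearMap.baseChange_tmul,
      tmul_mul_tmul, contr_mul_e, TensorProduct.tmul_sub, smul_sub, Finset.sum_sub_distrib,
      Finset.sum_mul, smul_mul_assoc, hsingle]

theorem vecContr_mul_extVec (w p : Fin (n + 1) → S) (x : S ⊗[k] ExtAlg k n) :
    vecContr w (x * extVec k p) = (p ⬝ᵥ w) • x - vecContr w x * extVec k p := by
  simp only [extVec, dotProduct, Finset.mul_sum, map_sum, vecContr_mul_tmul_e,
    Finset.sum_sub_distrib, Finset.sum_smul]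

theorem vecContr_mem_truncIdeal {r m : ℕ} {f : Fin r → Fin (n + 1) → S} {y : Fin m → S} {i b : ℕ}
    {w : Fin (n + 1) → S} (hw : ∀ a : Fin r, a.val < i → f a ⬝ᵥ w = 0) {x : S ⊗[k] ExtAlg k n}
    (hx : x ∈ truncIdeal (fun a => extVec k (f a)) (fun c => algebraMap S _ (y c)) i b) :
    vecContr w x ∈ truncIdeal (fun a => extVec k (f a)) (fun c => algebraMap S _ (y c)) i b := by
  induction hx using Submodule.closure_induction with
  | zero => simp
  | add x x' _ _ hx hx' => rw [map_add]; exact add_mem hx hx'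
  | smul_mem g x hx =>
    rcases hx with ⟨a, ha, rfl⟩ | ⟨c, hc, rfl⟩
    · rw [smul_eq_mul, vecContr_mul_extVec, hw a ha, zero_smul, zero_sub, ← neg_mul]
      exact Ideal.mul_mem_left _ _ (Ideal.subset_span (Or.inl ⟨a, ha, rfl⟩))
    · rw [smul_eq_mul, ← Algebra.commutes, ← Algebra.smul_def, map_smul, Algebra.smul_def,
        Algebra.commutes]
      exact Ideal.mul_mem_left _ _ (Ideal.subset_span (Or.inr ⟨c, hc, rfl⟩))

end ExteriorVectors

section Nullstellensatz

open MvPolynomial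

theorem exists_mul_eq_one_of_linearIndependent_row {K ι κ : Type*} [Field K] [Finite ι]
    [DecidableEq ι] [Fintype κ] {B : Matrix ι κ K} (hB : LinearIndependent K B.row) :
    ∃ Q : Matrix κ ι K, B * Q = 1 := by
  cases nonempty_fintype ι
  rw [← Matrix.mulVec_surjective_iff_exists_right_inverse]
  refine LinearMap.range_eq_top (f := B.mulVecLin).1 (Submodule.eq_top_of_finrank_eq ?_)
  rw [Module.finrank_fintype_fun_eq_card]
  exact hB.rank_matrix

variable {R : Type*} [CommRing R] {ι κ : Type*} [DecidableEq ι] [Fintype κ]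

/-- The ideal of the `p` such that `p` times the unit vector of index `a` is in the image of `F`. -/
def rowIdeal (F : Matrix ι κ R) (a : ι) : Ideal R :=
  Submodule.comap (LinearMap.single R (fun _ => R) a) (LinearMap.range F.mulVecLin)

theorem det_mul_mem_rowIdeal [Fintype ι] (F : Matrix ι κ R) (Q : Matrix κ ι R) (a : ι) :
    (F * Q).det ∈ rowIdeal F a := by
  refine ⟨(Q * (F * Q).adjugate).col a, ?_⟩
  have hcol : F.mulVec ((Q * (F * Q).adjugate).col a) = (F * Q * (F * Q).adjugate).col a := by
    rw [Matrix.mul_assoc]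
    rfl
  rw [Matrix.mulVecLin_apply, hcol, Matrix.mul_adjugate]
  ext a'
  simp [Matrix.one_apply, Pi.single_apply]

variable [Finite ι] {Ω : Type*} [Field Ω] [IsAlgClosed Ω]

theorem X_mem_radical_rowIdeal {σ : Type*} [Finite σ] {F : Matrix ι κ (MvPolynomial σ Ω)}
    (hF : ∀ u : σ → Ω, u ≠ 0 → LinearIndependent Ω (F.map (eval u)).row) (a : ι) (l : σ) :
    X l ∈ (rowIdeal F a).radical := by
  cases nonempty_fintype ι
  rw [← vanishingIdeal_zeroLocus_eq_radical (K := Ω)]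
  intro u hu
  by_contra hul
  have hu0 : u ≠ 0 := by
    rintro rfl
    exact hul (aeval_X _ l)
  obtain ⟨Q, hQ⟩ := exists_mul_eq_one_of_linearIndependent_row (hF u hu0)
  let P : Matrix κ ι (MvPolynomial σ Ω) := Q.map C
  have hP : P.map (eval u) = Q := by
    ext
    simp [P]
  have hdet : eval u (F * P).det = 1 := by
    rw [RingHom.map_det, RingHom.mapMatrix_apply, Matrix.map_mul, hP, hQ, Matrix.det_one]
  exact one_ne_zero (hdet.symm.trans (hu _ (det_mul_mem_rowIdeal F P a)))

theorem exists_mulVec_eq_single_X_pow {σ : Type*} [Finite σ] {F : Matrix ι κ (MvPolynomial σ Ω)}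
    (hF : ∀ u : σ → Ω, u ≠ 0 → LinearIndependent Ω (F.map (eval u)).row) (a : ι) (l : σ) :
    ∃ (N : ℕ) (w : κ → MvPolynomial σ Ω), F.mulVec w = Pi.single a (X l ^ N) :=
  X_mem_radical_rowIdeal hF a l

variable {k : Type*} [Field k] [Algebra k Ω] {n m r : ℕ}
  {F : Matrix (Fin r) (Fin (n + 1)) (MvPolynomial (Fin m) Ω)}

theorem regularAwayFromZeros_extVec (hF1 : ∀ a i, (F a i).IsHomogeneous 1)
    (hF : ∀ u : Fin m → Ω, u ≠ 0 → LinearIndependent Ω (F.map (eval u)).row) :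
    RegularAwayFromZeros (polyDegree (k := k)) (fun a => extVec k (F.row a))
      (polyVar k (ExtAlg k n) Ω) where
  z_mem c := tmul_mem_polyDegree (isHomogeneous_X Ω c) 1
  commute c x := Algebra.commutes _ x
  regular c _ := mem_truncIdeal_of_mul_polyVar_mem c
  mem_of_pos _ _ := mem_truncIdeal_of_mem_polyDegree
  ν_mem a := sum_mem fun i _ => tmul_mem_polyDegree (hF1 a i) _
  anticomm a b := extVec_mul_extVec_comm _ _
  sq_zero a := extVec_mul_self _
  torsion a c x hx := by
    obtain ⟨N, w, hw⟩ := exists_mulVec_eq_single_X_pow hF a c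
    have hdot (a' : Fin r) : F.row a' ⬝ᵥ w = (Pi.single a (X c ^ N) : Fin r → _) a' :=
      congrFun hw a'
    have hcontr := vecContr_mem_truncIdeal (fun a' ha' => by
      rw [hdot, Pi.single_eq_of_ne (Fin.ne_of_lt ha')]) hx
    rw [vecContr_mul_extVec, hdot, Pi.single_eq_same, ← mul_polyVar_pow] at hcontr
    refine ⟨N, ?_⟩
    rw [← sub_add_cancel (x * _) (vecContr w x * extVec k (F.row a))]
    exact add_mem (truncIdeal_mono a.val.le_succ le_rfl hcontr) (mul_mem_truncIdeal_succ_left _ a c)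

end Nullstellensatz

section LinearPairing

open MvPolynomial Algebra.TensorProduct

theorem coeff_mul_toMvPolynomial {ι κ R : Type*} [Fintype κ] [CommSemiring R]
    (B : Matrix ι κ R) (i : ι) (p : MvPolynomial κ R) (l : κ) :
    coeff (Finsupp.single l 1) (p * B.toMvPolynomial i) = coeff 0 p * B i l := by
  classical
  rw [Matrix.toMvPolynomial, Finset.mul_sum, coeff_sum, Finset.sum_eq_single l]
  · rw [coeff_mul_monomial', if_pos le_rfl, tsub_self]
  · intro l' _ hl
    rw [coeff_mul_monomial', if_neg]
    simpa [Finsupp.single_le_iff, Finsupp.single_apply] using hl.symm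
  · simp

variable {k Ω : Type*} [Field k] [Field Ω] [Algebra k Ω] {m : ℕ}

/-- The functional `p ⊗ y ↦ ∑ l, p_l * f l y` on `Ω[X] ⊗ Λ`, where `p_l` is the coefficient of `X l`
in `p`. -/
def linPairing {Λ : Type*} [AddCommGroup Λ] [Module k Λ] (f : Fin m → Λ →ₗ[k] k) :
    MvPolynomial (Fin m) Ω ⊗[k] Λ →ₗ[k] Ω :=
  ∑ l, LinearMap.mul' k Ω ∘ₗ TensorProduct.map
    ((lcoeff Ω (Finsupp.single l 1)).restrictScalars k) (Algebra.linearMap k Ω ∘ₗ f l)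

theorem linPairing_tmul {Λ : Type*} [AddCommGroup Λ] [Module k Λ] (f : Fin m → Λ →ₗ[k] k)
    (p : MvPolynomial (Fin m) Ω) (y : Λ) :
    linPairing f (p ⊗ₜ y) = ∑ l, coeff (Finsupp.single l 1) p * algebraMap k Ω (f l y) := by
  simp [linPairing, LinearMap.sum_apply]

theorem linPairing_X_tmul {Λ : Type*} [AddCommGroup Λ] [Module k Λ] (f : Fin m → Λ →ₗ[k] k)
    (l : Fin m) (y : Λ) :
    linPairing f ((X l : MvPolynomial (Fin m) Ω) ⊗ₜ y) = algebraMap k Ω (f l y) := by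
  simp [linPairing_tmul, coeff_X, Finsupp.single_left_inj]

variable {n r : ℕ} {d : Fin r → Matrix (Fin (n + 1)) (Fin m) Ω} {f : Fin m → ExtAlg k n →ₗ[k] k}

theorem linPairing_eq_zero_of_mem_truncIdeal
    (hf : ∀ a y, ∑ i, ∑ l, d a i l * algebraMap k Ω (f l (y * e k i)) = 0)
    {z : Fin m → MvPolynomial (Fin m) Ω ⊗[k] ExtAlg k n}
    {x : MvPolynomial (Fin m) Ω ⊗[k] ExtAlg k n}
    (hx : x ∈ truncIdeal (fun a => extVec k (d a).toMvPolynomial) z r 0) : linPairing f x = 0 := by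
  induction hx using Submodule.closure_induction with
  | zero => simp
  | add x x' _ _ hx hx' => rw [map_add, hx, hx', add_zero]
  | smul_mem g x hx =>
    rcases hx with ⟨a, -, rfl⟩ | ⟨c, hc, rfl⟩
    · rw [smul_eq_mul]
      induction g with
      | zero => simp
      | add g g' hg hg' => rw [add_mul, map_add, hg, hg', add_zero]
      | tmul p y =>
        simp only [extVec, Finset.mul_sum, map_sum, tmul_mul_tmul, linPairing_tmul,
          coeff_mul_toMvPolynomial, mul_assoc]
        simp only [← Finset.mul_sum, hf, mul_zero]
    · exact absurd hc (Nat.not_lt_zero _)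

theorem functional_prod_e_eq_zero_of_fin [IsAlgClosed Ω]
    (hd : ∀ u : Fin m → Ω, u ≠ 0 → LinearIndependent Ω fun a => (d a).mulVec u)
    (hf : ∀ a y, ∑ i, ∑ l, d a i l * algebraMap k Ω (f l (y * e k i)) = 0)
    (s : List (Fin (n + 1))) (hs : n + 1 < r + s.length) (l : Fin m) :
    f l (s.map (e k)).prod = 0 := by
  let F : Matrix (Fin r) (Fin (n + 1)) (MvPolynomial (Fin m) Ω) :=
    Matrix.of fun a => (d a).toMvPolynomial
  have hF (u : Fin m → Ω) : (F.map (eval u)).row = fun a => (d a).mulVec u := by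
    ext a i
    exact Matrix.toMvPolynomial_eval_eq_apply _ _ _
  have hregular : RegularAwayFromZeros (polyDegree (k := k)) (fun a => extVec k (F.row a))
      (polyVar k (ExtAlg k n) Ω) :=
    regularAwayFromZeros_extVec (fun a i => Matrix.toMvPolynomial_isHomogeneous _ _)
      fun u hu => (hF u).symm ▸ hd u hu
  have hprod : (X l ⊗ₜ[k] (s.map (e k)).prod) *
      ((List.ofFn fun a => extVec k (F.row a)).take r).reverse.prod = 0 := by
    have hmap : ((List.ofFn fun a => extVec k (F.row a)).take r).reverse =
        (List.ofFn F.row).reverse.map (extVec k) := by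
      rw [List.take_of_length_le (by simp), List.map_reverse, List.map_ofFn]
      rfl
    rw [hmap]
    exact tmul_prod_e_mul_prod_extVec_eq_zero _ _ s (by simpa [add_comm] using hs)
  have hmem := hregular.mem_of_mul_prod_eq_zero le_rfl (tmul_mem_polyDegree (isHomogeneous_X Ω l) _)
    hprod
  have hzero := linPairing_eq_zero_of_mem_truncIdeal hf hmem
  rwa [linPairing_X_tmul, map_eq_zero] at hzero

theorem functional_prod_e_eq_zero [IsAlgClosed Ω] {L : Type*} [Fintype L]
    {d : Fin r → Matrix (Fin (n + 1)) L Ω} {f : L → ExtAlg k n →ₗ[k] k}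
    (hd : ∀ u : L → Ω, u ≠ 0 → LinearIndependent Ω fun a => (d a).mulVec u)
    (hf : ∀ a y, ∑ i, ∑ l, d a i l * algebraMap k Ω (f l (y * e k i)) = 0)
    (s : List (Fin (n + 1))) (hs : n + 1 < r + s.length) (l : L) :
    f l (s.map (e k)).prod = 0 := by
  let ε := Fintype.equivFin L
  have hfin := functional_prod_e_eq_zero_of_fin (d := fun a => (d a).submatrix id ε.symm)
    (f := f ∘ ε.symm) (fun u hu => ?_) (fun a y => ?_) s hs (ε l)
  · simpa only [Function.comp_apply, ε.symm_apply_apply] using hfin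
  · simp_rw [Matrix.submatrix_mulVec_equiv, Function.comp_id, ε.symm_symm]
    exact hd _ fun h => hu (ε.surjective.injective_comp_right h)
  · rw [← hf a y]
    exact Finset.sum_congr rfl fun i _ =>
      ε.symm.sum_comp fun l => d a i l * algebraMap k Ω (f l (y * e k i))

end LinearPairing

section Transcendence

open AlgebraicIndependent MvPolynomial

variable {k Ω : Type*} [Field k] [Field Ω] [Algebra k Ω]

/-- The closure of `T` in the matroid `matroid k Ω` of algebraic independence, as a field: the
elements of `Ω` that are algebraic over `k(T)`. -/
def relClosure (k : Type*) {Ω : Type*} [Field k] [Field Ω] [Algebra k Ω] (T : Set Ω) :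
    IntermediateField k Ω :=
  (algebraicClosure (IntermediateField.adjoin k T) Ω).restrictScalars k

theorem coe_relClosure (T : Set Ω) : (relClosure k T : Set Ω) = (matroid k Ω).closure T := by
  rw [matroid_closure_eq]
  ext a
  exact (mem_algebraicClosure_iff (F := IntermediateField.adjoin k T)).trans
    IntermediateField.isAlgebraic_adjoin_iff

theorem subset_relClosure (T : Set Ω) : T ⊆ relClosure k T := by
  rw [coe_relClosure]
  exact (matroid k Ω).subset_closure T (Set.subset_univ T)

theorem relClosure_mono {S T : Set Ω} (h : S ⊆ T) : relClosure k S ≤ relClosure k T := by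
  rw [← SetLike.coe_subset_coe, coe_relClosure, coe_relClosure]
  exact (matroid k Ω).closure_subset_closure h

theorem eRk_le_eRk_of_subset_relClosure {S T : Set Ω} (h : S ⊆ relClosure k T) :
    (matroid k Ω).eRk S ≤ (matroid k Ω).eRk T := by
  rw [← (matroid k Ω).eRk_closure_eq T, ← coe_relClosure]
  exact (matroid k Ω).eRk_mono h

theorem eRk_range_of_algebraicIndependent {σ : Type*} [Fintype σ] {x : σ → Ω}
    (hx : AlgebraicIndependent k x) : (matroid k Ω).eRk (Set.range x) = Fintype.card σ := by
  rw [(matroid_indep_iff.2 hx.to_subtype_range).eRk_eq_encard, ← Set.image_univ,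
    hx.injective.encard_image, Set.encard_univ, ENat.card_eq_coe_fintype_card]

theorem eRk_range_le {σ : Type*} [Fintype σ] (x : σ → Ω) :
    (matroid k Ω).eRk (Set.range x) ≤ Fintype.card σ := by
  refine ((matroid k Ω).eRk_le_encard _).trans ?_
  rw [← Set.image_univ, ← ENat.card_eq_coe_fintype_card, ← Set.encard_univ]
  exact Set.encard_image_le x _

theorem map_mem_relClosure_of_isIntegralElem {σ R : Type*} [CommRing R] [Algebra k R]
    {g : MvPolynomial σ k →ₐ[k] R} (ψ : R →ₐ[k] Ω) {r : R} (hr : g.toRingHom.IsIntegralElem r) :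
    ψ r ∈ relClosure k (Set.range fun i => ψ (g (X i))) := by
  obtain ⟨P, hP, hPr⟩ := hr
  let K := IntermediateField.adjoin k (Set.range fun i => ψ (g (X i)))
  let G : MvPolynomial σ k →ₐ[k] K := aeval fun i =>
    ⟨ψ (g (X i)), IntermediateField.subset_adjoin _ _ ⟨i, rfl⟩⟩
  have hG : (algebraMap K Ω).comp G.toRingHom = ψ.toRingHom.comp g.toRingHom := by
    have : K.val.comp G = ψ.comp g := algHom_ext fun i => by simp [G]
    exact congrArg AlgHom.toRingHom this
  refine mem_algebraicClosure_iff'.2 ⟨P.map G.toRingHom, hP.map _, ?_⟩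
  rw [Polynomial.eval₂_map, hG]
  exact (Polynomial.hom_eval₂ P g.toRingHom ψ.toRingHom r).symm.trans (by rw [hPr, map_zero])

theorem ringKrullDim_le_of_isIntegral_of_injective {R S : Type*} [CommRing R] [CommRing S]
    {g : R →+* S} (hint : g.IsIntegral) (hg : Function.Injective g) :
    ringKrullDim R ≤ ringKrullDim S := by
  let := g.toAlgebra
  have : Algebra.IsIntegral R S := ⟨hint⟩
  refine iSup_le fun l => ?_
  have hker : (⊥ : Ideal S).comap (algebraMap R S) ≤ l.head.asIdeal := by
    rw [← RingHom.ker_eq_comap_bot]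
    exact ((RingHom.injective_iff_ker_eq_bot g).1 hg).le.trans bot_le
  obtain ⟨Q, -, hQ, hQl⟩ := Ideal.exists_ideal_over_prime_of_isIntegral l.head.asIdeal ⊥ hker
  have : Q.LiesOver l.head.asIdeal := ⟨hQl.symm⟩
  obtain ⟨L, hL, -⟩ := Ideal.exists_ltSeries_of_hasGoingUp l Q
  rw [← hL]
  exact le_iSup (fun p : LTSeries (PrimeSpectrum S) => (p.length : WithBot ℕ∞)) L

theorem eRk_range_le_ringKrullDim {ι : Type*} [Finite ι] (z : ι → Ω) :
    (((matroid k Ω).eRk (Set.range z) : ℕ∞) : WithBot ℕ∞) ≤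
      ringKrullDim (MvPolynomial ι k ⧸ RingHom.ker (aeval z : MvPolynomial ι k →ₐ[k] Ω)) := by
  set φ : MvPolynomial ι k →ₐ[k] Ω := aeval z
  have : (RingHom.ker φ).IsPrime := RingHom.ker_isPrime φ
  obtain ⟨d, g, hg, hint⟩ := exists_integral_inj_algHom_of_fg k (MvPolynomial ι k ⧸ RingHom.ker φ)
  have hz : Set.range z ⊆
      relClosure k (Set.range fun i => Ideal.kerLiftAlg φ (g (X i))) := by
    rintro _ ⟨i, rfl⟩
    have hzi : Ideal.kerLiftAlg φ (Ideal.Quotient.mk _ (X i)) = z i := aeval_X z i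
    rw [← hzi]
    exact map_mem_relClosure_of_isIntegralElem _ (hint _)
  have hd : ringKrullDim (MvPolynomial (Fin d) k) = d := by
    rw [ringKrullDim_of_isNoetherianRing, ringKrullDim_eq_zero_of_field, zero_add, Nat.card_fin]
  calc (((matroid k Ω).eRk (Set.range z) : ℕ∞) : WithBot ℕ∞)
    _ ≤ d := by
      have hle := (eRk_le_eRk_of_subset_relClosure hz).trans (eRk_range_le _)
      rw [Fintype.card_fin] at hle
      exact_mod_cast hle
    _ = ringKrullDim (MvPolynomial (Fin d) k) := hd.symm
    _ ≤ _ := ringKrullDim_le_of_isIntegral_of_injective hint hg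

end Transcendence

section LinearSystem

open Matrix

variable {F Ω I J : Type*} [Field F] [Field Ω] [Algebra F Ω]

theorem exists_linearIndepOn_row_card_eq_rank [Finite I] [Fintype J] (A : Matrix I J F) :
    ∃ S : Finset I, S.card = A.rank ∧ LinearIndepOn F A.row S ∧
      ∀ i, A.row i ∈ Submodule.span F (A.row '' S) := by
  classical
  cases nonempty_fintype I
  obtain ⟨b, -, -, hspan, hb⟩ := exists_linearIndepOn_extension
    (linearIndepOn_empty F A.row) (Set.empty_subset Set.univ)
  rw [Set.image_univ, Set.range_subset_iff] at hspan
  refine ⟨b.toFinset, ?_, by rwa [Set.coe_toFinset], by rwa [Set.coe_toFinset]⟩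
  have heq :
      Submodule.span F (Set.range A.row) = Submodule.span F (Set.range fun i : b => A.row i) :=
    le_antisymm (Submodule.span_le.2 (Set.range_subset_iff.2 (by rwa [← Set.image_eq_range])))
      (Submodule.span_mono (Set.range_comp_subset_range _ _))
  rw [rank_eq_finrank_span_row, heq, finrank_span_eq_card hb, Set.toFinset_card]

variable [Fintype I] {A : Matrix I J F} {S : Finset I}

theorem exists_vecMul_map_eq_zero (hS : ∀ i, A.row i ∈ Submodule.span F (A.row '' S)) (τ : I → Ω) :
    ∃ w : I → Ω, (∀ i ∉ S, w i = τ i) ∧ w ᵥ* A.map (algebraMap F Ω) = 0 := by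
  classical
  simp only [Submodule.mem_span_image_finset_iff_exists_fun'] at hS
  choose c hc using hS
  have hrow (i : I) : (A.map (algebraMap F Ω)).row i =
      ∑ s ∈ S, algebraMap F Ω (c i s) • (A.map (algebraMap F Ω)).row s := by
    ext j
    simpa [Algebra.smul_def] using congrArg (algebraMap F Ω) (congrFun (hc i) j).symm
  refine ⟨fun s => if s ∈ S then -∑ i ∈ Sᶜ, τ i * algebraMap F Ω (c i s) else τ s,
    fun i hi => if_neg hi, ?_⟩
  have hcompl : ∑ i ∈ Sᶜ, τ i • (A.map (algebraMap F Ω)).row i =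
      ∑ s ∈ S, (∑ i ∈ Sᶜ, τ i * algebraMap F Ω (c i s)) • (A.map (algebraMap F Ω)).row s := by
    simp only [Finset.sum_smul, mul_smul]
    rw [Finset.sum_comm]
    simp only [← Finset.smul_sum, ← hrow]
  rw [vecMul_eq_sum, ← Finset.sum_add_sum_compl S,
    Finset.sum_congr rfl fun s hs => by rw [if_pos hs],
    Finset.sum_congr (s₁ := Sᶜ) rfl fun s hs => by rw [if_neg (Finset.mem_compl.1 hs)]]
  refine (congrArg _ hcompl).trans ?_
  simp only [neg_smul, Finset.sum_neg_distrib]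
  exact neg_add_cancel _

theorem mem_of_vecMul_map_eq_zero [Finite J] (hS : LinearIndepOn F A.row S) {G : I → Ω}
    (hG : G ᵥ* A.map (algebraMap F Ω) = 0) {K : Submodule F Ω} (hK : ∀ i ∉ S, G i ∈ K) (i : I) :
    G i ∈ K := by
  classical
  cases nonempty_fintype J
  by_cases hi : i ∈ S
  swap
  · exact hK i hi
  obtain ⟨Q, hQ⟩ := exists_mul_eq_one_of_linearIndependent_row
    (B := A.submatrix ((↑) : S → I) id) hS
  have hQ (s : I) (hs : s ∈ S) : (A * Q) s ⟨i, hi⟩ = if s = i then 1 else 0 :=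
    (congrFun (congrFun hQ ⟨s, hs⟩) ⟨i, hi⟩).trans (by simp [one_apply])
  have hsum : ∑ s, (A * Q) s ⟨i, hi⟩ • G s = 0 := by
    have hGQ : G ᵥ* (A * Q).map (algebraMap F Ω) = 0 := by
      rw [Matrix.map_mul, ← vecMul_vecMul, hG, zero_vecMul]
    simpa [vecMul, dotProduct, Algebra.smul_def, mul_comm] using congrFun hGQ ⟨i, hi⟩
  rw [← Finset.sum_add_sum_compl S, Finset.sum_congr rfl fun s hs => by rw [hQ s hs]] at hsum
  simp only [ite_smul, one_smul, zero_smul, Finset.sum_ite_eq', hi, if_true] at hsum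
  rw [eq_neg_of_add_eq_zero_left hsum]
  exact neg_mem (sum_mem fun s hs => K.smul_mem _ (hK s (Finset.mem_compl.1 hs)))

end LinearSystem

section GenericCombinations

open AlgebraicIndependent Matrix

variable {k Ω I L T R : Type*} [Field k] [Field Ω] [Algebra k Ω]

theorem exists_algebraMap_eq_mulVec [Fintype L] (C : T → Matrix I L k) (u : L → Ω) :
    ∃ A : Matrix I T (IntermediateField.adjoin k (Set.range u)),
      ∀ i b, algebraMap _ Ω (A i b) = ((C b).map (algebraMap k Ω) *ᵥ u) i := by
  have hu (l : L) : u l ∈ IntermediateField.adjoin k (Set.range u) :=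
    IntermediateField.subset_adjoin _ _ ⟨l, rfl⟩
  refine ⟨of fun i b => ∑ l, algebraMap k _ (C b i l) * ⟨u l, hu l⟩, fun i b => ?_⟩
  simp only [of_apply, map_sum, map_mul]
  rfl

variable [Fintype T] [Fintype R]

theorem mem_of_vecMul_vecMul_eq_zero [Finite I] {κ K : IntermediateField k Ω} (hκ : κ ≤ K)
    {A : Matrix I T κ} {B : Finset T} (hB : LinearIndepOn κ Aᵀ.row B) {X : Matrix R T Ω}
    {s : R → Ω} {a₀ : R} (hs₀ : s a₀ = 1) (hG : (s ᵥ* X) ᵥ* Aᵀ.map (algebraMap κ Ω) = 0)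
    (hGK : ∀ b ∉ B, (s ᵥ* X) b ∈ K) (hs : ∀ a ≠ a₀, s a ∈ K) (hX : ∀ a ≠ a₀, ∀ b, X a b ∈ K)
    (b : T) : X a₀ b ∈ K := by
  classical
  have hGb : (s ᵥ* X) b ∈ K := mem_of_vecMul_map_eq_zero hB hG
    (K := Subalgebra.toSubmodule (IntermediateField.extendScalars hκ).toSubalgebra) hGK b
  rw [vecMul, dotProduct, ← Finset.add_sum_erase _ _ (Finset.mem_univ a₀), hs₀, one_mul] at hGb
  refine (add_mem_cancel_right (sum_mem fun a ha => ?_)).1 hGb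
  exact mul_mem (hs a (Finset.ne_of_mem_erase ha)) (hX a (Finset.ne_of_mem_erase ha) b)

variable [Fintype I] {x : (R × T) ⊕ I → Ω}

theorem card_add_one_le_eRk_add_card (hx : AlgebraicIndependent k x) {κ : IntermediateField k Ω}
    {A : Matrix I T κ} {s : R → Ω} {a₀ : R} (hs₀ : s a₀ = 1)
    (hG : (s ᵥ* of fun a b => x (.inl (a, b))) ᵥ* Aᵀ.map (algebraMap κ Ω) = 0)
    {S : Finset I} (hS : S.card = A.rank) {Z : Set Ω} (hκ : κ ≤ relClosure k Z)
    (hZ : ∀ i ∉ S, x (.inr i) ∈ relClosure k Z) :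
    (Fintype.card I + 1 : ℕ∞) ≤ (matroid k Ω).eRk Z + Fintype.card R := by
  classical
  obtain ⟨B, hBcard, hB, -⟩ := exists_linearIndepOn_row_card_eq_rank Aᵀ
  rw [rank_transpose] at hBcard
  -- All of `x` is algebraic over `Z` and `Y`: the coordinates outside `B` determine the whole
  -- combination of the rows `x (.inl (a, ·))`, hence also the row `a₀`, whose coefficient is `1`.
  let Y : (Bᶜ : Finset T) ⊕ {a // a ≠ a₀} ⊕ ({a // a ≠ a₀} × T) ⊕ S → Ω :=
    Sum.elim (fun b => (s ᵥ* of fun a b => x (.inl (a, b))) b)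
      (Sum.elim (fun a => s a) (Sum.elim (fun p => x (.inl (p.1, p.2))) (fun i => x (.inr i))))
  let K := relClosure k (Z ∪ Set.range Y)
  have hZK : relClosure k Z ≤ K := relClosure_mono Set.subset_union_left
  have hYK (i) : Y i ∈ K := subset_relClosure _ (.inr ⟨i, rfl⟩)
  have hxK (a : R) (ha : a ≠ a₀) (b : T) : x (.inl (a, b)) ∈ K :=
    hYK (.inr (.inr (.inl (⟨a, ha⟩, b))))
  have hrange : Set.range x ⊆ K := by
    rintro _ ⟨⟨a, b⟩ | i, rfl⟩
    · obtain rfl | ha := eq_or_ne a a₀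
      · exact mem_of_vecMul_vecMul_eq_zero (hκ.trans hZK) hB hs₀ hG
          (fun b hb => hYK (.inl ⟨b, Finset.mem_compl.2 hb⟩))
          (fun a ha => hYK (.inr (.inl ⟨a, ha⟩))) hxK b
      · exact hxK a ha b
    · by_cases hi : i ∈ S
      · exact hYK (.inr (.inr (.inr ⟨i, hi⟩)))
      · exact hZK (hZ i hi)
  have hrank := eRk_le_eRk_of_subset_relClosure hrange
  rw [eRk_range_of_algebraicIndependent hx] at hrank
  have hcard := hrank.trans (((matroid k Ω).eRk_union_le_eRk_add_eRk _ _).trans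
    (add_le_add_right (eRk_range_le Y) _))
  have hBT := B.card_le_univ
  have hR : Fintype.card R = Fintype.card {a // a ≠ a₀} + 1 := by
    rw [Fintype.card_subtype_compl, Fintype.card_subtype_eq, Nat.sub_add_cancel]
    exact Fintype.card_pos_iff.2 ⟨a₀⟩
  simp only [Fintype.card_sum, Fintype.card_prod, Fintype.card_coe, Finset.card_compl] at hcard
  generalize (matroid k Ω).eRk Z = z at hcard ⊢
  cases z with
  | top => simp
  | coe z =>
    norm_cast at hcard ⊢
    rw [hR, add_one_mul] at hcard
    omega

theorem exists_rank_one_of_sum_smul_eq_zero [Fintype L] (hx : AlgebraicIndependent k x)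
    (C : T → Matrix I L k) (hcard : Fintype.card L + Fintype.card R ≤ Fintype.card I + 1)
    {u : L → Ω} {l₀ : L} (hu : u l₀ = 1) {s : R → Ω} {a₀ : R} (hs₀ : s a₀ = 1)
    (hsum : ∑ a, s a • (∑ b, x (.inl (a, b)) • (C b).map (algebraMap k Ω)) *ᵥ u = 0) :
    ∃ w : I → Ω, (∀ b, w ⬝ᵥ (C b).map (algebraMap k Ω) *ᵥ u = 0) ∧
      (Fintype.card I + 1 : ℕ∞) ≤
        (matroid k Ω).eRk (Set.range fun p : I × L => w p.1 * u p.2) + Fintype.card R := by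
  classical
  obtain ⟨A, hA⟩ := exists_algebraMap_eq_mulVec C u
  have hG : (s ᵥ* of fun a b => x (.inl (a, b))) ᵥ* Aᵀ.map (algebraMap _ Ω) = 0 := by
    rw [← hsum, vecMul_vecMul, vecMul_eq_sum]
    refine Finset.sum_congr rfl fun a _ => congrArg (s a • ·) (funext fun i => ?_)
    simp [mul_apply, hA, sum_mulVec, smul_mulVec]
  obtain ⟨S, hS, -, hSspan⟩ := exists_linearIndepOn_row_card_eq_rank A
  obtain ⟨w, hwS, hwA⟩ := exists_vecMul_map_eq_zero hSspan fun i => x (.inr i)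
  have hcount {Z : Set Ω} (huZ : ∀ l, u l ∈ relClosure k Z)
      (hxZ : ∀ i ∉ S, x (.inr i) ∈ relClosure k Z) :
      (Fintype.card I + 1 : ℕ∞) ≤ (matroid k Ω).eRk Z + Fintype.card R :=
    card_add_one_le_eRk_add_card hx hs₀ hG hS
      (IntermediateField.adjoin_le_iff.2 (Set.range_subset_iff.2 huZ)) hxZ
  obtain ⟨i₀, hi₀⟩ : ∃ i, i ∉ S := by
    by_contra! hall
    have h := (hcount (Z := Set.range fun l : {l // l ≠ l₀} => u l) (fun l => ?_)
      fun i hi => absurd (hall i) hi).trans (add_le_add_left (eRk_range_le _) _)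
    · rw [Fintype.card_subtype_compl, Fintype.card_subtype_eq] at h
      have := Fintype.card_pos_iff.2 ⟨l₀⟩
      norm_cast at h
      omega
    · obtain rfl | hl := eq_or_ne l l₀
      · exact hu ▸ one_mem _
      · exact subset_relClosure _ ⟨⟨l, hl⟩, rfl⟩
  have hwu (i : I) (l : L) :
      w i * u l ∈ relClosure k (Set.range fun p : I × L => w p.1 * u p.2) :=
    subset_relClosure _ ⟨(i, l), rfl⟩
  have hw (i : I) := by simpa only [hu, mul_one] using hwu i l₀
  have hwi₀ : w i₀ ≠ 0 := hwS i₀ hi₀ ▸ hx.ne_zero _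
  refine ⟨w, fun b => ?_, hcount (fun l => ?_) fun i hi => hwS i hi ▸ hw i⟩
  · refine Eq.trans ?_ (congrFun hwA b)
    exact Finset.sum_congr rfl fun i _ => congrArg (w i * ·) (hA i b).symm
  · simpa only [mul_div_cancel_left₀ _ hwi₀] using div_mem (hwu i₀ l) (hw i₀)

theorem exists_rank_one_of_not_linearIndependent [Fintype L] (hx : AlgebraicIndependent k x)
    (C : T → Matrix I L k) (hcard : Fintype.card L + Fintype.card R ≤ Fintype.card I + 1)
    {u : L → Ω} (hu : u ≠ 0) (hdep : ¬ LinearIndependent Ω fun a =>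
      (∑ b, x (.inl (a, b)) • (C b).map (algebraMap k Ω)) *ᵥ u) :
    ∃ (w : I → Ω) (u : L → Ω), (∀ b, w ⬝ᵥ (C b).map (algebraMap k Ω) *ᵥ u = 0) ∧
      (Fintype.card I + 1 : ℕ∞) ≤
        (matroid k Ω).eRk (Set.range fun p : I × L => w p.1 * u p.2) + Fintype.card R := by
  obtain ⟨l₀, hl₀⟩ := Function.ne_iff.1 hu
  obtain ⟨s, hs, a₀, ha₀⟩ := Fintype.not_linearIndependent_iff.1 hdep
  obtain ⟨w, hw⟩ := exists_rank_one_of_sum_smul_eq_zero hx C hcard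
    (u := (u l₀)⁻¹ • u) (inv_mul_cancel₀ hl₀) (s := (s a₀)⁻¹ • s) (inv_mul_cancel₀ ha₀) <| by
      simp only [Pi.smul_apply, smul_assoc, mulVec_smul, smul_comm _ (u l₀)⁻¹,
        ← Finset.smul_sum, hs, smul_zero]
  exact ⟨w, _, hw⟩

end GenericCombinations

section RankOneLocus

open Matrix MvPolynomial

theorem exists_forall_eq_sum_dual_smul {k M I : Type*} [Field k] [AddCommGroup M] [Module k M]
    [Finite I] (v : I → M) : ∃ (t : ℕ) (g : Fin t → M) (φ : Fin t → Module.Dual k M),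
      ∀ i, v i = ∑ b, φ b (v i) • g b := by
  have : FiniteDimensional k (Submodule.span k (Set.range v)) :=
    FiniteDimensional.span_of_finite k (Set.finite_range v)
  let B := Module.finBasis k (Submodule.span k (Set.range v))
  choose φ hφ using fun b => (B.coord b).exists_extend
  refine ⟨_, fun b => B b, φ, fun i => ?_⟩
  let vi : Submodule.span k (Set.range v) := ⟨v i, Submodule.subset_span ⟨i, rfl⟩⟩
  have hφv (b) : φ b (v i) = B.repr vi b := LinearMap.congr_fun (hφ b) vi
  simpa only [hφv, Submodule.coe_sum, Submodule.coe_smul] using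
    (congrArg Subtype.val (B.sum_repr vi)).symm

theorem exists_eq_vecMulVec_of_minors_eq_zero {F I J : Type*} [Field F] (A : Matrix I J F)
    (hA : ∀ i i' j j', A i j * A i' j' - A i j' * A i' j = 0) :
    ∃ (u : I → F) (v : J → F), A = vecMulVec u v := by
  by_cases hzero : A = 0
  · exact ⟨0, 0, by rw [hzero, zero_vecMulVec]⟩
  · obtain ⟨i₀, j₀, hne⟩ : ∃ i₀ j₀, A i₀ j₀ ≠ 0 := by
      by_contra! h
      exact hzero (Matrix.ext h)
    refine ⟨fun i => A i j₀, fun j => A i₀ j / A i₀ j₀, Matrix.ext fun i j => ?_⟩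
    rw [vecMulVec_apply, mul_div_assoc', eq_div_iff hne]
    exact sub_eq_zero.1 (hA i i₀ j j₀)

theorem ringKrullDim_quotient_le_topologicalKrullDim {R : Type*} [CommRing R] {I : Ideal R}
    {Z : Set (PrimeSpectrum R)} (hZ : PrimeSpectrum.zeroLocus I ⊆ Z) :
    ringKrullDim (R ⧸ I) ≤ topologicalKrullDim Z := by
  rw [← PrimeSpectrum.topologicalKrullDim_eq_ringKrullDim]
  have hind : Topology.IsInducing (PrimeSpectrum.comap (Ideal.Quotient.mk I)) :=
    (PrimeSpectrum.isClosedEmbedding_comap_of_surjective _ _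
      Ideal.Quotient.mk_surjective).isInducing
  have hrange := range_comap_of_surjective _ _ (Ideal.Quotient.mk_surjective (I := I))
  rw [Ideal.mk_ker] at hrange
  exact (hind.codRestrict fun q => hZ (hrange.le ⟨q, rfl⟩)).topologicalKrullDim_le

variable {k : Type*} [Field k] {A : Type*} {n : ℕ}
variable {M : Type*} [AddCommGroup M] [Module k M] [Module (MvPolynomial (Fin (n + 1)) k) M]

/-- The matrix of the bilinear form `(x, m) ↦ φ (x m)` on `W × M_a`, where `W` is the span of the
variables. -/
def mulMatrix (ℳ : A → Submodule k M) (a : A) (φ : Module.Dual k M) :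
    Matrix (Fin (n + 1)) (BasisIndex ℳ a) k :=
  of fun i l => φ ((X i : MvPolynomial (Fin (n + 1)) k) •
    (Module.Basis.ofVectorSpace k (ℳ a) l : M))

variable {ℳ : A → Submodule k M} {a : A} [Fintype (BasisIndex ℳ a)]

theorem mem_rankOneSyzygies {t : ℕ} {g : Fin t → M} {φ : Fin t → Module.Dual k M}
    (hφ : ∀ i l, (X i : MvPolynomial (Fin (n + 1)) k) •
      (Module.Basis.ofVectorSpace k (ℳ a) l : M) = ∑ b, mulMatrix ℳ a (φ b) i l • g b)
    (p : PrimeSpectrum (CoordRing n ℳ a))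
    (hminor : ∀ i i' l l', (X (i, l) * X (i', l') - X (i, l') * X (i', l) : CoordRing n ℳ a) ∈
      p.asIdeal)
    (hlin : ∀ b, (∑ i, ∑ l, mulMatrix ℳ a (φ b) i l • X (i, l) : CoordRing n ℳ a) ∈ p.asIdeal) :
    p ∈ rankOneSyzygies n ℳ a := by
  let ev : CoordRing n ℳ a →ₐ[k] p.asIdeal.ResidueField := IsScalarTower.toAlgHom _ _ _
  have hev {z : CoordRing n ℳ a} (hz : z ∈ p.asIdeal) : ev z = 0 :=
    Ideal.algebraMap_residueField_eq_zero.2 hz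
  obtain ⟨u, v, huv⟩ := exists_eq_vecMulVec_of_minors_eq_zero (of fun i l => ev (X (i, l)))
    fun i i' l l' => by simpa only [map_sub, map_mul, of_apply] using hev (hminor i i' l l')
  have huv (i l) : ev (X (i, l)) = u i * v l := congrFun₂ huv i l
  have hsum (i) : (Finsupp.equivFunOnFinite.symm v).sum (fun l c => (u i * c) ⊗ₜ[k]
      ((X i : MvPolynomial (Fin (n + 1)) k) • (Module.Basis.ofVectorSpace k (ℳ a) l : M))) =
      ∑ b, (∑ l, mulMatrix ℳ a (φ b) i l • ev (X (i, l))) ⊗ₜ[k] g b := by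
    rw [Finsupp.sum_fintype _ _ (by simp)]
    simp only [Finsupp.equivFunOnFinite_symm_apply_apply, ← huv, hφ, TensorProduct.tmul_sum,
      TensorProduct.sum_tmul, TensorProduct.tmul_smul, TensorProduct.smul_tmul']
    exact Finset.sum_comm
  refine ⟨u, Finsupp.equivFunOnFinite.symm v, huv, ?_⟩
  simp only [hsum]
  rw [Finset.sum_comm]
  refine Finset.sum_eq_zero fun b _ => ?_
  have hlinb := hev (hlin b)
  simp only [map_sum, map_smul] at hlinb
  rw [← TensorProduct.sum_tmul, hlinb, TensorProduct.zero_tmul]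

theorem eRk_range_le_topologicalKrullDim_rankOneSyzygies {t : ℕ} {g : Fin t → M}
    {φ : Fin t → Module.Dual k M}
    (hφ : ∀ i l, (X i : MvPolynomial (Fin (n + 1)) k) •
      (Module.Basis.ofVectorSpace k (ℳ a) l : M) = ∑ b, mulMatrix ℳ a (φ b) i l • g b)
    {Ω : Type*} [Field Ω] [Algebra k Ω] {w : Fin (n + 1) → Ω} {u : BasisIndex ℳ a → Ω}
    (hwu : ∀ b, w ⬝ᵥ (mulMatrix ℳ a (φ b)).map (algebraMap k Ω) *ᵥ u = 0) :
    (((AlgebraicIndependent.matroid k Ω).eRk (Set.range fun p : _ × _ => w p.1 * u p.2) : ℕ∞) :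
      WithBot ℕ∞) ≤ topologicalKrullDim (rankOneSyzygies n ℳ a) := by
  refine (eRk_range_le_ringKrullDim _).trans (ringKrullDim_quotient_le_topologicalKrullDim
    fun p hp => mem_rankOneSyzygies hφ p (fun i i' l l' => hp ?_) fun b => hp ?_)
  · rw [SetLike.mem_coe, RingHom.mem_ker]
    simp only [map_sub, map_mul, aeval_X]
    ring
  · rw [SetLike.mem_coe, RingHom.mem_ker, ← hwu b]
    simp only [map_sum, map_smul, aeval_X, dotProduct, mulVec, map_apply, Finset.mul_sum]
    simp only [Algebra.smul_def, mul_left_comm]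

end RankOneLocus

section Coordinates

open Matrix

theorem exists_isAlgClosed_algebraicIndependent.{u₁, u₂} (k : Type u₁) [Field k] (σ : Type u₂) :
    ∃ (Ω : Type (max u₁ u₂)) (_ : Field Ω) (_ : Algebra k Ω) (_ : IsAlgClosed Ω) (x : σ → Ω),
      AlgebraicIndependent k x := by
  let Ω := AlgebraicClosure (FractionRing (MvPolynomial σ k))
  refine ⟨Ω, inferInstance, inferInstance, inferInstance,
    fun i => algebraMap (MvPolynomial σ k) Ω (.X i), ?_⟩
  exact (MvPolynomial.algebraicIndependent_X σ k).map'
    (f := IsScalarTower.toAlgHom k (MvPolynomial σ k) Ω)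
    (((algebraMap (FractionRing (MvPolynomial σ k)) Ω).injective).comp
      (IsFractionRing.injective _ _))

variable {k : Type*} [Field k] {n : ℕ}

theorem span_range_prod_e :
    Submodule.span k (Set.range fun s : List (Fin (n + 1)) => (s.map (e k)).prod) = ⊤ := by
  rw [eq_top_iff]
  rintro y -
  induction y using ExteriorAlgebra.induction with
  | algebraMap r =>
    rw [Algebra.algebraMap_eq_smul_one]
    exact Submodule.smul_mem _ _ (Submodule.subset_span ⟨[], rfl⟩)
  | ι v =>
    rw [pi_eq_sum_univ' v, map_sum]
    refine sum_mem fun i _ => ?_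
    rw [map_smul]
    exact Submodule.smul_mem _ _ (Submodule.subset_span ⟨[i], List.prod_singleton⟩)
  | mul y z hy hz =>
    have hyz := Submodule.mul_mem_mul hy hz
    rw [Submodule.span_mul_span] at hyz
    refine Submodule.span_mono ?_ hyz
    rintro _ ⟨_, ⟨s, rfl⟩, _, ⟨s', rfl⟩, rfl⟩
    exact ⟨s ++ s', by simp⟩
  | add y z hy hz => exact add_mem hy hz

theorem OmegaE.eq_zero_of_forall_prod_e {f : OmegaE k n}
    (hf : ∀ s : List (Fin (n + 1)), f.toDual (s.map (e k)).prod = 0) : f = 0 :=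
  LinearMap.ext_on_range (v := fun s : List (Fin (n + 1)) => (s.map (e k)).prod)
    span_range_prod_e hf

variable {A : Type*} {M : Type*} [AddCommGroup M] [Module k M] {ℳ : A → Submodule k M} {a : A}

theorem sum_mulMatrix_mul_toDual_eq_zero [Module (MvPolynomial (Fin (n + 1)) k) M]
    [IsScalarTower k (MvPolynomial (Fin (n + 1)) k) M] [Fintype (BasisIndex ℳ a)]
    {f : BasisIndex ℳ a → OmegaE k n}
    (hf : dR ℳ a (∑ l, f l ⊗ₜ Module.Basis.ofVectorSpace k (ℳ a) l) = 0) (φ : Module.Dual k M)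
    (x : ExtAlg k n) : ∑ i, ∑ l, mulMatrix ℳ a φ i l * (f l).toDual (x * e k i) = 0 := by
  let ev : OmegaE k n →ₗ[k] k :=
    { toFun := fun f => f.toDual x, map_add' := fun _ _ => rfl, map_smul' := fun _ _ => rfl }
  have hev (i l) : ev (e k i • f l) = -(f l).toDual (x * e k i) := by
    change (e k i • f l).toDual x = _
    rw [OmegaE.smul_apply, involute_e, mul_neg, map_neg]
  have h := congrArg (TensorProduct.lift ((LinearMap.mul k k).compl₁₂ ev φ)) hf
  simp only [map_sum, dR, LinearMap.sum_apply, TensorProduct.map_tmul, map_zero,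
    TensorProduct.lift.tmul, LinearMap.compl₁₂_apply, Algebra.lsmul_coe, hev] at h
  rw [Finset.sum_comm, ← neg_eq_zero, ← h]
  simp only [LinearMap.mul_apply', neg_mul, Finset.sum_neg_distrib, mul_comm (OmegaE.toDual _ _)]
  rfl

variable [AddCommGroup A] {w : Fin (n + 1) → A}

theorem toDual_prod_e_eq_zero {c : A} {j : ℤ} {f : OmegaE k n} (hf : f ∈ omegaComp k w c j)
    {s : List (Fin (n + 1))} (hs : (s.length : ℤ) ≠ j) : f.toDual (s.map (e k)).prod = 0 :=
  hf _ _ (fun h => hs (neg_injective (congrArg Prod.snd h))) _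
    (Submodule.subset_span ⟨s, rfl, rfl, rfl⟩)

variable [Fintype (BasisIndex ℳ a)]

theorem exists_eq_sum_tmul_of_mem_summandComp {c : A} {j : ℤ} {y : OmegaE k n ⊗[k] ℳ a}
    (hy : y ∈ summandComp w ℳ a c j) :
    ∃ f : BasisIndex ℳ a → OmegaE k n, (∀ l, f l ∈ omegaComp k w (c - a) j) ∧
      y = ∑ l, f l ⊗ₜ Module.Basis.ofVectorSpace k (ℳ a) l := by
  obtain ⟨z, rfl⟩ := hy
  obtain ⟨f, rfl⟩ := TensorProduct.eq_repr_basis_right (Module.Basis.ofVectorSpace k (ℳ a)) z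
  refine ⟨fun l => f l, fun l => (f l).2, ?_⟩
  rw [Finsupp.sum_fintype _ _ (by simp), map_sum]
  rfl

variable [Module (MvPolynomial (Fin (n + 1)) k) M]
  [IsScalarTower k (MvPolynomial (Fin (n + 1)) k) M]

theorem eq_zero_of_mem_Kcomp {Ω : Type*} [Field Ω] [IsAlgClosed Ω] [Algebra k Ω] {r t : ℕ}
    {φ : Fin t → Module.Dual k M} {ξ : Fin r → Fin t → Ω}
    (hξ : ∀ u : BasisIndex ℳ a → Ω, u ≠ 0 → LinearIndependent Ω fun α =>
      (∑ b, ξ α b • (mulMatrix (n := n) ℳ a (φ b)).map (algebraMap k Ω)) *ᵥ u)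
    {c : A} {j : ℕ} (hj : n + 1 < r + j) {y : OmegaE k n ⊗[k] ℳ a}
    (hy : y ∈ Kcomp w ℳ a c j) : y = 0 := by
  obtain ⟨f, hfdeg, rfl⟩ := exists_eq_sum_tmul_of_mem_summandComp hy.2
  have hlin (α : Fin r) (x : ExtAlg k n) : ∑ i, ∑ l,
      (∑ b, ξ α b • (mulMatrix ℳ a (φ b)).map (algebraMap k Ω)) i l *
        algebraMap k Ω ((f l).toDual (x * e k i)) = 0 := by
    simp only [Matrix.sum_apply, Matrix.smul_apply, map_apply, smul_eq_mul, Finset.sum_mul,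
      mul_assoc, ← map_mul]
    rw [Finset.sum_congr rfl fun i _ => Finset.sum_comm, Finset.sum_comm]
    refine Finset.sum_eq_zero fun b _ => ?_
    simp only [← Finset.mul_sum, ← map_sum, sum_mulMatrix_mul_toDual_eq_zero hy.1, map_zero,
      mul_zero]
  refine Finset.sum_eq_zero fun l _ => ?_
  suffices hfl : f l = 0 by rw [hfl, TensorProduct.zero_tmul]
  refine OmegaE.eq_zero_of_forall_prod_e fun s => ?_
  by_cases hs : s.length = j
  · exact functional_prod_e_eq_zero (f := fun l => (f l).toDual) hξ hlin s (hs ▸ hj) l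
  · exact toDual_prod_e_eq_zero (hfdeg l) (Nat.cast_injective.ne hs)

theorem natCast_le_topologicalKrullDim_rankOneSyzygies {c : A} {j : ℕ}
    (hj : Fintype.card (BasisIndex ℳ a) ≤ j) (hK : Kcomp w ℳ a c j ≠ ⊥) :
    (j : WithBot ℕ∞) ≤ topologicalKrullDim (rankOneSyzygies n ℳ a) := by
  obtain ⟨t, g, φ, hφ⟩ := exists_forall_eq_sum_dual_smul (k := k)
    fun p : Fin (n + 1) × BasisIndex ℳ a => (MvPolynomial.X p.1 : MvPolynomial (Fin (n + 1)) k) •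
      (Module.Basis.ofVectorSpace k (ℳ a) p.2 : M)
  obtain ⟨Ω, _, _, _, x, hx⟩ := exists_isAlgClosed_algebraicIndependent k
    ((Fin (n + 2 - j) × Fin t) ⊕ Fin (n + 1))
  by_cases hind : ∀ u : BasisIndex ℳ a → Ω, u ≠ 0 → LinearIndependent Ω fun α =>
      (∑ b, x (.inl (α, b)) • (mulMatrix (n := n) ℳ a (φ b)).map (algebraMap k Ω)) *ᵥ u
  · refine absurd ((Submodule.eq_bot_iff _).2 fun y hy => ?_) hK
    exact eq_zero_of_mem_Kcomp hind (by omega) hy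
  · push Not at hind
    obtain ⟨u, hu, hdep⟩ := hind
    obtain ⟨i⟩ : Nonempty (Fin (n + 2 - j)) :=
      not_isEmpty_iff.1 fun _ => hdep linearIndependent_empty_type
    have hr := i.pos
    obtain ⟨v, u', hvu, hle⟩ := exists_rank_one_of_not_linearIndependent hx
      (fun b => mulMatrix ℳ a (φ b)) (by simp only [Fintype.card_fin]; omega) hu hdep
    refine le_trans (WithBot.coe_le_coe.2 ?_)
      (eRk_range_le_topologicalKrullDim_rankOneSyzygies (fun i l => hφ (i, l)) hvu)
    simp only [Fintype.card_fin] at hle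
    generalize (AlgebraicIndependent.matroid k Ω).eRk _ = ρ at hle ⊢
    cases ρ with
    | top => exact le_top
    | coe ρ =>
      norm_cast at hle ⊢
      omega

end Coordinates

section Strand

theorem coe_complexLength_le {R : Type*} [Ring R] {C : ChainComplex (ModuleCat R) ℤ}
    {b : WithBot ℕ∞} (hb : b ≠ ⊥) (hC : ∀ j : ℕ, Nontrivial (C.X (j : ℤ)) → (j : WithBot ℕ∞) ≤ b) :
    (complexLength C : WithBot ℕ∞) ≤ b := by
  lift b to ℕ∞ using hb
  exact WithBot.coe_le_coe.2 (iSup₂_le fun j hj => WithBot.coe_le_coe.1 (hC j hj))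

theorem exists_Kcomp_ne_bot {k : Type*} [Field k] {A : Type*} [AddCommGroup A] [DecidableEq A]
    {n : ℕ} {w : Fin (n + 1) → A} {M : Type*} [AddCommGroup M] [Module k M]
    [Module (MvPolynomial (Fin (n + 1)) k) M] [IsScalarTower k (MvPolynomial (Fin (n + 1)) k) M]
    {ℳ : A → Submodule k M} {a : A} {j : ℤ}
    (hj : Nontrivial ((stronglyLinearStrand w ℳ a).X j)) : ∃ c, Kcomp w ℳ a c j ≠ ⊥ := by
  by_contra! hbot
  have hterm : Nontrivial (LTerm n (Kcomp w ℳ a) j) := hj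
  refine not_subsingleton (LTerm n (Kcomp w ℳ a) j) ⟨fun x y => ?_⟩
  ext c : 1
  have : Subsingleton (Kcomp w ℳ a c j) := by
    rw [hbot c]
    infer_instance
  exact Subsingleton.elim _ _

end Strand

end MultigradedLST

end

open MultigradedLST in
theorem mainTheorem3_general {k : Type*} [Field k] {A : Type*} [AddCommGroup A] [DecidableEq A]
    {n : ℕ} (w : Fin (n + 1) → A)
    {M : Type*} [AddCommGroup M] [Module k M] [Module (MvPolynomial (Fin (n + 1)) k) M]
    [IsScalarTower k (MvPolynomial (Fin (n + 1)) k) M] (ℳ : A → Submodule k M) (a : A) :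
    ((complexLength (stronglyLinearStrand w ℳ a) : ℕ∞) : WithBot ℕ∞) ≤
      max ((Cardinal.toENat (Module.rank k (ℳ a)) - 1 : ℕ∞) : WithBot ℕ∞)
        (topologicalKrullDim (rankOneSyzygies n ℳ a)) := by
  refine coe_complexLength_le (ne_bot_of_le_ne_bot WithBot.coe_ne_bot (le_max_left _ _))
    fun j hj => ?_
  by_cases hfin : FiniteDimensional k (ℳ a)
  · have := FiniteDimensional.fintypeBasisIndex (Module.Basis.ofVectorSpace k (ℳ a))
    rw [rank_eq_card_basis (Module.Basis.ofVectorSpace k (ℳ a)), map_natCast]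
    obtain hlt | hge := lt_or_ge j (Fintype.card (BasisIndex ℳ a))
    · exact le_max_of_le_left (WithBot.coe_le_coe.2 (by exact_mod_cast Nat.le_sub_one_of_lt hlt))
    · obtain ⟨c, hc⟩ := exists_Kcomp_ne_bot hj
      exact le_max_of_le_right (natCast_le_topologicalKrullDim_rankOneSyzygies hge hc)
  · have htop : Cardinal.toENat (Module.rank k (ℳ a)) = ⊤ :=
      Cardinal.toENat_eq_top.2 (not_lt.1 (mt Module.rank_lt_aleph0_iff.1 hfin))
    rw [htop]
    exact le_max_of_le_left (WithBot.coe_le_coe.2 le_top)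

open MultigradedLST in
theorem mainTheorem3 {k : Type*} [Field k] {A : Type*} [AddCommGroup A] [DecidableEq A]
    {n : ℕ} (w : Fin (n + 1) → A)
    {M : Type*} [AddCommGroup M] [Module k M] [Module (MvPolynomial (Fin (n + 1)) k) M]
    [IsScalarTower k (MvPolynomial (Fin (n + 1)) k) M]
    (ℳ : A → Submodule k M) [DirectSum.Decomposition ℳ]
    [SetLike.GradedSMul (MvPolynomial.weightedHomogeneousSubmodule k w) ℳ]
    (hM : BoundedBelow w ℳ) (a : A) (ha : IsMinimalEff w ℳ a) :
    ((complexLength (stronglyLinearStrand w ℳ a) : ℕ∞) : WithBot ℕ∞) ≤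
      max ((Cardinal.toENat (Module.rank k (ℳ a)) - 1 : ℕ∞) : WithBot ℕ∞)
        (topologicalKrullDim (rankOneSyzygies n ℳ a)) :=
  mainTheorem3_general w ℳ a
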